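/- Let $n,N\ge 0$ be integers. On $\bigotimes_{i=1}^n\ell_2\cong\ell^2(\mathbb N^n)$, with number vectors $e_k$ ($k\in\mathbb N^n$), let $\hat a_i e_k=\sqrt{k_i}\,e_{k-\delta_i}$ and $\hat a_i^\dagger e_k=\sqrt{k_i+1}\,e_{k+\delta_i}$ be the bosonic annihilation and creation operators on the space $\mathcal D$ of finite linear combinations of the $e_k$, and let $\mathfrak a=(\hat a_1,\dots,\hat a_n,\hat a_1^\dagger,\dots,\hat a_n^\dagger)^T$. Put $$J=\begin{pmatrix}0&-I_n\\ I_n&0\end{pmatrix},\qquad E=\begin{pmatrix}0&I_n\\ I_n&0\end{pmatrix},\qquad \tilde K=E\overline KE .$$ Let $K_1,\dots,K_N\in\mathbb C^{2n\times 2n}$ satisfy $K_j=K_j^T=\tilde K_j$, and let $C_j=\frac12\mathfrak a^TK_j\mathfrak a$, which is a symmetric operator on $\mathcal D$. Let $\rho_t$, $t\ge 0$, be density matrices (positive operators of trace one) that satisfy $$\frac{d}{dt}\rho_t=-\frac12\sum_{j=1}^N[C_j,[C_j,\rho_t]]$$ weakly, that is, for all $\varphi,\psi\in\mathcal D$ and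 $t\ge 0$ (with the one-sided derivative at $t=0$), $$\frac{d}{dt}\langle\varphi,\rho_t\psi\rangle=-\frac12\sum_{j=1}^N\bigl(\langle C_j^2\varphi,\rho_t\psi\rangle-2\langle C_j\varphi,\rho_tC_j\psi\rangle+\langle\varphi,\rho_tC_j^2\psi\rangle\bigr).$$ Say that $\rho$ has finite moments of order $m$ if $\operatorname{tr}(|A|\rho)=\sum_k\|Ae_k\|\,\langle e_k,\rho e_k\rangle<\infty$ for every component $A=\mathfrak a_{i_1}\cdots\mathfrak a_{i_m}$ of $\otimes_{l=1}^m\mathfrak a$. The moment tensor $\langle\otimes_{l=1}^m\mathfrak a\rangle_t$ has the components $\operatorname{tr}(A\rho_t)=\sum_k\langle A^\dagger e_k,\rho_te_k\rangle$, where $A^\dagger=\mathfrak a_{i_m}^\dagger\cdots\mathfrak a_{i_1}^\dagger$. Let $m\ge 0$. If $\rho_0$ has finite moments of order $m$, then for every $t\ge 0$ the density matrix $\rho_t$ has finite moments of order $m$, the series defining $\langle\otimes_{l=1}^m\mathfrak a\rangle_t$ converge absolutely, and $$\langle\otimes_{l=1}^m\mathfrak a\rangle_t=\exp\Bigl(-\frac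 t2\sum_{j=1}^N\sum_{i,p=1}^m\otimes_{l=1}^m(JK_j)^{\delta_{il}+\delta_{pl}}\Bigr)\langle\otimes_{l=1}^m\mathfrak a\rangle_0 .$$ In particular, if $\rho_0$ has finite moments of order $1$, then for every $t\ge0$ $$\langle\mathfrak a\rangle_t=\exp\Bigl(-\frac t2\sum_{j=1}^N(JK_j)^2\Bigr)\langle\mathfrak a\rangle_0,$$ and if $\rho_0$ has finite moments of order $2$, then for every $t\ge0$ $$\langle\mathfrak a\otimes\mathfrak a\rangle_t=\exp\Bigl(-\frac t2\sum_{j=1}^N\bigl(I_{2n}\otimes(JK_j)^2+2\,(JK_j)\otimes(JK_j)+(JK_j)^2\otimes I_{2n}\bigr)\Bigr)\langle\mathfrak a\otimes\mathfrak a\rangle_0 .$$ -/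

import Mathlib

open scoped InnerProductSpace Kronecker Matrix

noncomputable section

namespace BosonicDiffusion

/-- Occupation numbers of `n` bosonic modes. -/
abbrev Occ (n : ℕ) : Type := Fin n → ℕ

/-- The Hilbert space `ℓ²(ℕⁿ)`, that is, the `n`-fold Hilbert tensor power of `ℓ²`, with the
product vectors as orthonormal basis indexed by `ℕⁿ`. -/
abbrev Fock (n : ℕ) : Type := lp (fun _ : Occ n => ℂ) 2

/-- Finite linear combinations of number vectors: the common invariant domain on which all
polynomials in creation and annihilation operators are defined. -/
abbrev FinVec (n : ℕ) : Type := Occ n →₀ ℂ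

/-- The number vector `e_k` as an element of the finite-particle space. -/
abbrev numVec {n : ℕ} (k : Occ n) : FinVec n := Finsupp.single k 1

/-- Inclusion of the finite-particle space in the Hilbert space. -/
def incl (n : ℕ) : FinVec n →ₗ[ℂ] Fock n :=
  Finsupp.linearCombination ℂ (fun k : Occ n => (lp.single 2 k (1 : ℂ) : Fock n))

/-- Annihilation operator of mode `i`: `e_k ↦ √(k_i) e_{k - δ_i}` (zero if `k_i = 0`). -/
def annihilation {n : ℕ} (i : Fin n) : Module.End ℂ (FinVec n) :=
  Finsupp.linearCombination ℂ
    (fun k : Occ n => Finsupp.single (k - Pi.single i 1) ((Real.sqrt (k i) : ℝ) : ℂ))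

/-- Creation operator of mode `i`: `e_k ↦ √(k_i + 1) e_{k + δ_i}`. -/
def creation {n : ℕ} (i : Fin n) : Module.End ℂ (FinVec n) :=
  Finsupp.linearCombination ℂ
    (fun k : Occ n => Finsupp.single (k + Pi.single i 1) ((Real.sqrt (k i + 1) : ℝ) : ℂ))

/-- Index set of the `2n` components of the vector `𝔞`. -/
abbrev Idx (n : ℕ) : Type := Fin n ⊕ Fin n

/-- The vector `𝔞 = (a_1, …, a_n, a_1†, …, a_n†)`. -/
def ladder {n : ℕ} : Idx n → Module.End ℂ (FinVec n) :=
  Sum.elim annihilation creation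

/-- The operator `½ 𝔞ᵀ K 𝔞`. -/
def quadOp {n : ℕ} (K : Matrix (Idx n) (Idx n) ℂ) : Module.End ℂ (FinVec n) :=
  (1 / 2 : ℂ) • ∑ i, ∑ j, K i j • (ladder i * ladder j)

/-- The matrix `E` with blocks `0, I; I, 0`. -/
def matE (n : ℕ) : Matrix (Idx n) (Idx n) ℂ := Matrix.fromBlocks 0 1 1 0

/-- The conjugation `K̃ = E K̄ E`, the bar being the entrywise complex conjugation. -/
def tildeConj {n : ℕ} (K : Matrix (Idx n) (Idx n) ℂ) : Matrix (Idx n) (Idx n) ℂ :=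
  matE n * K.map (starRingEnd ℂ) * matE n

/-- Density matrices: positive operators of trace one. -/
structure IsDensityMatrix {n : ℕ} (ρ : Fock n →L[ℂ] Fock n) : Prop where
  isPositive : ρ.IsPositive
  trace_eq_one : HasSum (fun k : Occ n => ⟪incl n (numVec k), ρ (incl n (numVec k))⟫_ℂ) 1

/-- Matrix element `⟨φ, [C, [C, ρ]] ψ⟩` of a double commutator, `C` being a symmetric operator
on the finite-particle space: `C²ρ - 2CρC + ρC²`, where the factors `C` on the left of `ρ` act
on `φ`. -/
def doubleCommElem {n : ℕ} (C : Module.End ℂ (FinVec n)) (ρ : Fock n →L[ℂ] Fock n)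
    (φ ψ : FinVec n) : ℂ :=
  ⟪incl n (C (C φ)), ρ (incl n ψ)⟫_ℂ - 2 * ⟪incl n (C φ), ρ (incl n (C ψ))⟫_ℂ
    + ⟪incl n φ, ρ (incl n (C (C ψ)))⟫_ℂ

/-- `ρ_t`, `t ≥ 0`, are density matrices that satisfy `dρ/dt = -½ ∑ⱼ [Cⱼ, [Cⱼ, ρ]]` in the weak
sense, that is, in all matrix elements between finite-particle vectors. -/
structure IsSolution {n N : ℕ} (C : Fin N → Module.End ℂ (FinVec n))
    (ρ : ℝ → (Fock n →L[ℂ] Fock n)) : Prop where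
  isDensityMatrix : ∀ t : ℝ, 0 ≤ t → IsDensityMatrix (ρ t)
  hasDeriv : ∀ t : ℝ, 0 ≤ t → ∀ φ ψ : FinVec n,
    HasDerivWithinAt (fun s : ℝ => ⟪incl n φ, ρ s (incl n ψ)⟫_ℂ)
      (-(1 / 2 : ℂ) * ∑ j, doubleCommElem (C j) (ρ t) φ ψ) (Set.Ici 0) t

/-- The component `𝔞_{I₁} ⋯ 𝔞_{I_m}` of `⊗ᵐ 𝔞`. -/
def monomial {n m : ℕ} (I : Fin m → Idx n) : Module.End ℂ (FinVec n) :=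
  (List.ofFn (fun l => ladder (I l))).prod

/-- The adjoint `𝔞_{I_m}† ⋯ 𝔞_{I₁}†` of `𝔞_{I₁} ⋯ 𝔞_{I_m}`. -/
def monomialAdj {n m : ℕ} (I : Fin m → Idx n) : Module.End ℂ (FinVec n) :=
  monomial (fun l => (I l.rev).swap)

/-- Diagonal element `⟨e_k, 𝔞_{I₁} ⋯ 𝔞_{I_m} ρ e_k⟩`, the product of ladder operators being
moved to the left argument. -/
def traceTerm {n m : ℕ} (ρ : Fock n →L[ℂ] Fock n) (I : Fin m → Idx n) (k : Occ n) : ℂ :=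
  ⟪incl n (monomialAdj I (numVec k)), ρ (incl n (numVec k))⟫_ℂ

/-- The moment tensor `⟨⊗ᵐ 𝔞⟩ = tr (⊗ᵐ 𝔞 ρ)`. -/
def momentTensor {n : ℕ} (m : ℕ) (ρ : Fock n →L[ℂ] Fock n) : (Fin m → Idx n) → ℂ :=
  fun I => ∑' k : Occ n, traceTerm ρ I k

/-- Finiteness of the moments of order `m`: `tr (|A| ρ) < ∞` for every component `A` of `⊗ᵐ 𝔞`.
Such an `A` maps the number vectors to multiples of distinct number vectors, so that
`|A| = (A†A)^{1/2}` is diagonal, with diagonal elements `‖A e_k‖`. -/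
def FiniteMoments {n : ℕ} (m : ℕ) (ρ : Fock n →L[ℂ] Fock n) : Prop :=
  ∀ I : Fin m → Idx n, Summable (fun k : Occ n =>
    ‖incl n (monomial I (numVec k))‖ * (⟪incl n (numVec k), ρ (incl n (numVec k))⟫_ℂ).re)

/-- The Kronecker product `⊗_{l=1}^m A_l`. -/
def kroneckerProd {n m : ℕ} (A : Fin m → Matrix (Idx n) (Idx n) ℂ) :
    Matrix (Fin m → Idx n) (Fin m → Idx n) ℂ :=
  Matrix.of fun I I' => ∏ l, A l (I l) (I' l)

end BosonicDiffusion

end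

/-! Formally, cyclicity of the trace moves the double commutator from the state to the observable:
the derivative of tr(Aρ_t) is -½ Σ_j tr([C_j,[C_j,A]]ρ_t). By the canonical commutation relations,
[C_j, 𝔞_l] is the combination of the 𝔞_i with coefficients (JK_j)_{li}. Hence [C_j, ·] acts on words
of length m as the derivation D_j = Σ_l 1⊗…⊗JK_j⊗…⊗1 (`quadOp_commutator_monomial`). The moments of
order m thus obey a closed linear system with generator -½ Σ_j D_j², and D_j² expands into the
double sum over i and p.

The work lies in justifying this for unbounded A and C_j and a merely weak equation. With N the
total number operator, A is replaced by f(N)A, where f vanishes at large numbers. Then tr(ρ f(N)A)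
is a finite combination of matrix elements and can be differentiated
(`IsSolution.hasDerivWithinAt_tr`). The price is the terms in which f is commuted with C_j. Since
C_j has the size of N and shifts N by at most 2, [C_j, f(N)] is governed by N·Δf, and [C_j,[C_j,
f(N)]] by N·Δf and N²·Δ²f. This singles out functions that vary on a logarithmic scale (`LogSym`).
Schur's test (`IsDensityMatrix.norm_tr_le`), based on |ρ_kl| ≤ (ρ_kk + ρ_ll)/2, turns such operator
bounds into weighted sums of populations.

The estimate is used twice. If φ is log-like, the dissipator applied to the weight exp φ(N) is
bounded by a multiple of that weight, so Grönwall's inequality bounds the weighted populations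
(`IsSolution.exists_summable_exp`), with a rate that depends on φ only through its constants. The
weight comparable to (N+1)^{m/2} propagates finiteness of moments; the same weight times
(N²+1)/(N²+R), log-like uniformly in R, shows that the tails are small uniformly on [0,t]
(`IsSolution.exists_tsum_tail_le`). For a sequence of slowly varying cutoffs (`exists_cutoffs`) the
error terms are bounded by these tails, so the truncated moments solve the linear system up to an
error that tends to zero. Stability of linear systems (`exists_norm_sub_exp_mulVec_le`) and
dominated convergence finish the proof. -/

noncomputable section

namespace BosonicDiffusion

open Filter Topology

variable {n : ℕ}

/-- The ring structure of `Module.End ℂ (FinVec n)`, over the additive group structure of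
`FinVec n`; instance search does not see that its subtraction is that of linear maps. -/
instance (priority := 10000) instRingEndFinVec : Ring (Module.End ℂ (FinVec n)) :=
  Module.End.instRing (N₁ := FinVec n)

instance (priority := 10000) instSubEndFinVec : Sub (Module.End ℂ (FinVec n)) :=
  instRingEndFinVec.toSub

/-! ### Ladder operators on number vectors -/

theorem end_ext {X Y : Module.End ℂ (FinVec n)} (h : ∀ k, X (numVec k) = Y (numVec k)) : X = Y :=
  Finsupp.lhom_ext' fun k => LinearMap.ext_ring (h k)

theorem annihilation_numVec (i : Fin n) (k : Occ n) :
    annihilation i (numVec k) =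
      Finsupp.single (k - Pi.single i 1) ((Real.sqrt (k i) : ℝ) : ℂ) := by
  simp [annihilation]

theorem creation_numVec (i : Fin n) (k : Occ n) :
    creation i (numVec k) =
      Finsupp.single (k + Pi.single i 1) ((Real.sqrt (k i + 1) : ℝ) : ℂ) := by
  simp [creation]

theorem single_eq_smul_numVec (k : Occ n) (z : ℂ) :
    (Finsupp.single k z : FinVec n) = z • numVec k := by simp

theorem annihilation_numVec' (i : Fin n) (k : Occ n) :
    annihilation i (numVec k) = ((Real.sqrt (k i) : ℝ) : ℂ) • numVec (k - Pi.single i 1) := by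
  simp [annihilation]

theorem creation_numVec' (i : Fin n) (k : Occ n) :
    creation i (numVec k) = ((Real.sqrt (k i + 1) : ℝ) : ℂ) • numVec (k + Pi.single i 1) := by
  simp [creation]

/-! ### Commutation relations -/

theorem sub_single_of_ne {i j : Fin n} (h : i ≠ j) (k : Occ n) :
    (k - Pi.single j 1 : Occ n) i = k i := by simp [h]

theorem annihilation_comm (i j : Fin n) :
    annihilation i * annihilation j = annihilation (n := n) j * annihilation i := by
  rcases eq_or_ne i j with rfl | h
  · rfl
  refine end_ext fun k => ?_
  simp only [Module.End.mul_apply, annihilation_numVec', map_smul, smul_smul]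
  rw [sub_single_of_ne h, sub_single_of_ne h.symm, mul_comm]
  congr 2
  rw [tsub_right_comm]

theorem creation_comm (i j : Fin n) :
    creation i * creation j = creation (n := n) j * creation i := by
  rcases eq_or_ne i j with rfl | h
  · rfl
  refine end_ext fun k => ?_
  simp only [Module.End.mul_apply, creation_numVec', map_smul, smul_smul]
  have h1 : (k + Pi.single j 1 : Occ n) i = k i := by simp [h]
  have h2 : (k + Pi.single i 1 : Occ n) j = k j := by simp [h.symm]
  rw [h1, h2, mul_comm, add_right_comm]

theorem add_single_sub_single (i : Fin n) (k : Occ n) :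
    (k + Pi.single i 1 - Pi.single i 1 : Occ n) = k := by
  ext j; simp

theorem sub_single_add_single {i : Fin n} {k : Occ n} (h : k i ≠ 0) :
    (k - Pi.single i 1 + Pi.single i 1 : Occ n) = k := by
  ext j
  rcases eq_or_ne j i with rfl | hj
  · simp; omega
  · simp [hj]

theorem annihilation_creation_comm (i j : Fin n) :
    annihilation i * creation j - creation j * annihilation i =
      (if i = j then (1 : Module.End ℂ (FinVec n)) else 0) := by
  refine end_ext fun k => ?_
  rcases eq_or_ne i j with rfl | h
  · simp only [LinearMap.sub_apply, Module.End.mul_apply, creation_numVec', annihilation_numVec',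
      map_smul, smul_smul, add_single_sub_single, if_true, Module.End.one_apply]
    by_cases hk : k i = 0
    · simp [hk]
    · rw [sub_single_add_single hk, ← sub_smul]
      have h1 : (((k - Pi.single i 1 : Occ n) i : ℕ) : ℝ) + 1 = k i := by
        have : (k - Pi.single i 1 : Occ n) i + 1 = k i := by simp; omega
        exact_mod_cast this
      have h2 : (((k + Pi.single i 1 : Occ n) i : ℕ) : ℝ) = k i + 1 := by simp
      rw [h1, h2]
      rw [← Complex.ofReal_mul, ← Complex.ofReal_mul, Real.mul_self_sqrt (by positivity),
        Real.mul_self_sqrt (by positivity)]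
      push_cast
      rw [add_sub_cancel_left, one_smul]
  · simp only [LinearMap.sub_apply, Module.End.mul_apply, creation_numVec', annihilation_numVec',
      map_smul, smul_smul, if_neg h, LinearMap.zero_apply]
    have h1 : (k + Pi.single j 1 : Occ n) i = k i := by simp [h]
    rw [h1, sub_single_of_ne h.symm]
    by_cases hk : k i = 0
    · simp [hk]
    · have : (k + Pi.single j 1 - Pi.single i 1 : Occ n) = k - Pi.single i 1 + Pi.single j 1 := by
        ext l
        rcases eq_or_ne l i with rfl | hl
        · simp [h]
        · simp [hl]
      rw [this, mul_comm, sub_self]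

/-- The canonical commutation relations `[𝔞_i, 𝔞_j] = -J_{ij}`. -/
theorem ladder_comm (i j : Idx n) :
    ladder i * ladder j - ladder j * ladder i =
      (-(Matrix.J (Fin n) ℂ i j)) • (1 : Module.End ℂ (FinVec n)) := by
  rcases i with i | i <;> rcases j with j | j
  · simp [ladder, annihilation_comm i j, Matrix.J]
  · simp [ladder, annihilation_creation_comm i j, Matrix.J, Matrix.one_apply]
  · have := annihilation_creation_comm j i
    rw [← neg_sub] at this
    simp only [ladder, Sum.elim_inl, Sum.elim_inr, Matrix.J, Matrix.fromBlocks_apply₂₁]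
    rw [neg_eq_iff_eq_neg] at this
    rw [this]
    rcases eq_or_ne i j with rfl | h
    · simp
    · simp [h, h.symm]
  · simp [ladder, creation_comm i j, Matrix.J]

/-! ### Functions of the total number -/

/-- Total occupation number. -/
def level (k : Occ n) : ℤ := ∑ i, (k i : ℤ)

theorem level_nonneg (k : Occ n) : 0 ≤ level k := Finset.sum_nonneg fun _ _ => by positivity

theorem level_add_single (k : Occ n) (i : Fin n) : level (k + Pi.single i 1) = level k + 1 := by
  simp [level, Finset.sum_add_distrib, Pi.single_apply]

theorem level_sub_single {k : Occ n} {i : Fin n} (h : k i ≠ 0) :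
    level (k - Pi.single i 1) = level k + -1 := by
  have := level_add_single (k - Pi.single i 1) i
  rw [sub_single_add_single h] at this
  omega

/-- The operator `f(N)`, with `N` the total number operator. -/
def diag (f : ℤ → ℝ) : Module.End ℂ (FinVec n) :=
  Finsupp.linearCombination ℂ fun k : Occ n => Finsupp.single k ((f (level k) : ℝ) : ℂ)

theorem diag_numVec (f : ℤ → ℝ) (k : Occ n) :
    diag f (numVec k) = ((f (level k) : ℝ) : ℂ) • numVec k := by simp [diag]

/-- Change of the total number effected by a ladder operator. -/
def shift : Idx n → ℤ := Sum.elim (fun _ => -1) (fun _ => 1)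

/-- Each ladder operator moves the total number by exactly `shift i`. Where the truncated
subtraction in `annihilation` would spoil this, at `k i = 0`, the coefficient vanishes. -/
theorem diag_mul_ladder (f : ℤ → ℝ) (i : Idx n) :
    diag f * ladder i = ladder i * diag (fun x => f (x + shift i)) := by
  refine end_ext fun k => ?_
  rcases i with i | i
  · simp only [ladder, shift, Sum.elim_inl, Module.End.mul_apply, annihilation_numVec', diag_numVec,
      map_smul, smul_smul]
    by_cases hk : k i = 0
    · simp [hk]
    · rw [level_sub_single hk, mul_comm]
  · simp only [ladder, shift, Sum.elim_inr, Module.End.mul_apply, creation_numVec', diag_numVec,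
      map_smul, smul_smul]
    rw [level_add_single, mul_comm]

theorem diag_mul_word (f : ℤ → ℝ) (i j : Idx n) :
    diag f * (ladder i * ladder j) =
      ladder i * ladder j * diag (fun x => f (x + (shift i + shift j))) := by
  rw [← mul_assoc, diag_mul_ladder, mul_assoc, diag_mul_ladder, ← mul_assoc]
  congr 3
  funext x
  rw [add_assoc, add_comm (shift j)]

theorem diag_sub (f g : ℤ → ℝ) : (diag (fun x => f x - g x) : Module.End ℂ (FinVec n)) =
    diag f - diag g := by
  refine end_ext fun k => ?_
  simp [diag_numVec, sub_smul]

/-! ### Adjoints on the finite-particle space -/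

theorem inner_incl_numVec (k l : Occ n) :
    ⟪incl n (numVec k), incl n (numVec l)⟫_ℂ = if k = l then 1 else 0 := by
  simp only [incl, Finsupp.linearCombination_single, one_smul]
  rw [lp.inner_single_left, lp.coeFn_single]
  by_cases h : k = l
  · subst h; simp
  · simp [h]

theorem inner_incl_numVec_left (k : Occ n) (v : FinVec n) :
    ⟪incl n (numVec k), incl n v⟫_ℂ = v k := by
  induction v using Finsupp.induction_linear with
  | zero => simp
  | add f g hf hg => rw [map_add, inner_add_right, hf, hg]; rfl
  | single l z =>
    rw [single_eq_smul_numVec, map_smul, inner_smul_right, inner_incl_numVec]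
    by_cases h : k = l
    · subst h; simp
    · simp [h]

/-- `Y` is the adjoint of `X` on the finite-particle space. -/
def IsAdj (X Y : Module.End ℂ (FinVec n)) : Prop :=
  ∀ φ ψ : FinVec n, ⟪incl n φ, incl n (X ψ)⟫_ℂ = ⟪incl n (Y φ), incl n ψ⟫_ℂ

namespace IsAdj

variable {X X' Y Y' : Module.End ℂ (FinVec n)}

theorem symm (h : IsAdj X Y) : IsAdj Y X := fun φ ψ => by
  rw [← inner_conj_symm, ← h, inner_conj_symm]

theorem mul (h : IsAdj X X') (h' : IsAdj Y Y') : IsAdj (X * Y) (Y' * X') := fun φ ψ => by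
  simp only [Module.End.mul_apply]
  rw [h, h']

theorem add (h : IsAdj X X') (h' : IsAdj Y Y') : IsAdj (X + Y) (X' + Y') := fun φ ψ => by
  simp only [LinearMap.add_apply, map_add, inner_add_left, inner_add_right, h φ ψ, h' φ ψ]

theorem sub (h : IsAdj X X') (h' : IsAdj Y Y') : IsAdj (X - Y) (X' - Y') := fun φ ψ => by
  simp only [LinearMap.sub_apply, map_sub, inner_sub_left, inner_sub_right, h φ ψ, h' φ ψ]

theorem smul (h : IsAdj X X') (c : ℂ) : IsAdj (c • X) ((starRingEnd ℂ c) • X') := fun φ ψ => by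
  simp only [LinearMap.smul_apply, map_smul, inner_smul_left, inner_smul_right, h φ ψ,
    Complex.conj_conj]

theorem zero : IsAdj (0 : Module.End ℂ (FinVec n)) 0 := fun φ ψ => by simp

theorem one : IsAdj (1 : Module.End ℂ (FinVec n)) 1 := fun φ ψ => by simp

theorem sum {ι : Type*} (s : Finset ι) {X X' : ι → Module.End ℂ (FinVec n)}
    (h : ∀ i, IsAdj (X i) (X' i)) : IsAdj (∑ i ∈ s, X i) (∑ i ∈ s, X' i) := by
  classical
  induction s using Finset.induction_on with
  | empty => simpa using zero
  | insert a s ha ih => rw [Finset.sum_insert ha, Finset.sum_insert ha]; exact (h a).add ih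

theorem commutator (h : IsAdj X X') (h' : IsAdj Y Y') :
    IsAdj (X * Y - Y * X) (Y' * X' - X' * Y') := (h.mul h').sub (h'.mul h)

theorem apply_eq (h : IsAdj X X') (k l : Occ n) :
    X (numVec k) l = starRingEnd ℂ (X' (numVec l) k) := by
  rw [← inner_incl_numVec_left, h, ← inner_incl_numVec_left, inner_conj_symm]

theorem of_apply (h : ∀ k l, X (numVec k) l = starRingEnd ℂ (X' (numVec l) k)) :
    IsAdj X X' := by
  intro φ ψ
  induction ψ using Finsupp.induction_linear with
  | zero => simp
  | add f g hf hg => simp only [map_add, inner_add_right, hf, hg]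
  | single k z =>
    induction φ using Finsupp.induction_linear with
    | zero => simp
    | add f g hf hg => simp only [map_add, inner_add_left, hf, hg]
    | single l w =>
      rw [single_eq_smul_numVec k, single_eq_smul_numVec l]
      simp only [map_smul, inner_smul_left, inner_smul_right]
      rw [inner_incl_numVec_left, h, ← inner_conj_symm, inner_incl_numVec_left]

end IsAdj

theorem isAdj_creation (i : Fin n) : IsAdj (creation i) (annihilation i) := by
  refine IsAdj.of_apply fun k l => ?_
  rw [creation_numVec, annihilation_numVec, Finsupp.single_apply, Finsupp.single_apply]
  by_cases hl : l i = 0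
  · have : k + Pi.single i 1 ≠ l := by rintro rfl; simp at hl
    simp [hl, this]
  · by_cases h : k + Pi.single i 1 = l
    · subst h; simp
    · have : l - Pi.single i 1 ≠ k := by rintro rfl; exact h (sub_single_add_single hl)
      simp [h, this]

theorem isAdj_ladder (i : Idx n) : IsAdj (ladder i) (ladder i.swap) := by
  rcases i with i | i
  · exact (isAdj_creation i).symm
  · exact isAdj_creation i

theorem isAdj_diag (f : ℤ → ℝ) : IsAdj (diag f : Module.End ℂ (FinVec n)) (diag f) := by
  refine IsAdj.of_apply fun k l => ?_
  rw [diag_numVec, diag_numVec]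
  by_cases h : k = l
  · subst h; simp
  · simp [h, Ne.symm h]

theorem tildeConj_apply (K : Matrix (Idx n) (Idx n) ℂ) (i j : Idx n) :
    tildeConj K i j = starRingEnd ℂ (K i.swap j.swap) := by
  rcases i with i | i <;> rcases j with j | j <;>
    simp [tildeConj, matE, Matrix.mul_apply, Fintype.sum_sum_type, Matrix.one_apply]

/-- Taking adjoints reverses each word, swaps the two halves of the index set and conjugates the
coefficients. The two symmetries of `K` say that the resulting sum is a reindexing of the original
one. -/
theorem isAdj_quadOp {K : Matrix (Idx n) (Idx n) ℂ} (hs : Kᵀ = K) (ht : tildeConj K = K) :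
    IsAdj (quadOp K) (quadOp K) := by
  have h1 : IsAdj (quadOp K) ((starRingEnd ℂ (1 / 2 : ℂ)) •
      ∑ i, ∑ j, (starRingEnd ℂ (K i j)) • (ladder j.swap * ladder i.swap)) :=
    (IsAdj.sum _ fun i => IsAdj.sum _ fun j =>
      ((isAdj_ladder i).mul (isAdj_ladder j)).smul _).smul _
  convert h1 using 1
  rw [quadOp]
  congr 1
  · norm_num [Complex.ext_iff]
  · rw [Finset.sum_comm, ← (Equiv.sumComm (Fin n) (Fin n)).sum_comp]
    refine Finset.sum_congr rfl fun i _ => ?_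
    rw [← (Equiv.sumComm (Fin n) (Fin n)).sum_comp]
    refine Finset.sum_congr rfl fun j _ => ?_
    have h2 : K j.swap i.swap = starRingEnd ℂ (K i j) := by
      conv_lhs => rw [← hs, Matrix.transpose_apply, ← ht, tildeConj_apply]
      simp
    simp only [Equiv.sumComm_apply, h2]

theorem monomial_zero (I : Fin 0 → Idx n) : monomial I = 1 := by simp [monomial]

theorem monomial_succ {m : ℕ} (I : Fin (m + 1) → Idx n) :
    monomial I = ladder (I 0) * monomial (fun l => I l.succ) := by
  simp [monomial, List.ofFn_succ]

theorem monomial_snoc {m : ℕ} (I : Fin (m + 1) → Idx n) :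
    monomial I = monomial (fun l : Fin m => I l.castSucc) * ladder (I (Fin.last m)) := by
  rw [monomial, List.ofFn_succ', List.prod_concat]
  rfl

theorem isAdj_monomial {m : ℕ} (I : Fin m → Idx n) : IsAdj (monomial I) (monomialAdj I) := by
  induction m with
  | zero => rw [monomialAdj, monomial_zero, monomial_zero]; exact IsAdj.one
  | succ m ih =>
    rw [monomial_succ, monomialAdj, monomial_snoc]
    simp only [Fin.rev_last, Fin.rev_castSucc]
    exact (isAdj_ladder _).mul (ih _)

/-! ### The `ℓ¹` norm of finite-particle vectors -/

/-- The `ℓ¹` norm of the coefficients. -/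
def l1 (v : FinVec n) : ℝ := v.sum fun _ z => ‖z‖

theorem l1_eq_sum {v : FinVec n} {s : Finset (Occ n)} (h : v.support ⊆ s) :
    l1 v = ∑ k ∈ s, ‖v k‖ := Finsupp.sum_of_support_subset _ h _ (by simp)

theorem l1_nonneg (v : FinVec n) : 0 ≤ l1 v := Finset.sum_nonneg fun _ _ => norm_nonneg _

theorem sum_norm_le_l1 (v : FinVec n) (s : Finset (Occ n)) : ∑ k ∈ s, ‖v k‖ ≤ l1 v := by
  rw [l1_eq_sum (s := s ∪ v.support) Finset.subset_union_right]
  exact Finset.sum_le_sum_of_subset_of_nonneg Finset.subset_union_left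
    fun _ _ _ => norm_nonneg _

@[simp] theorem l1_zero : l1 (0 : FinVec n) = 0 := by simp [l1]

theorem l1_smul_numVec (k : Occ n) (z : ℂ) : l1 (z • numVec k) = ‖z‖ := by
  simp [l1]

theorem l1_add_le (v w : FinVec n) : l1 (v + w) ≤ l1 v + l1 w := by
  rw [l1_eq_sum (s := v.support ∪ w.support) Finsupp.support_add,
    l1_eq_sum (v := v) (s := v.support ∪ w.support) Finset.subset_union_left,
    l1_eq_sum (v := w) (s := v.support ∪ w.support) Finset.subset_union_right,
    ← Finset.sum_add_distrib]
  exact Finset.sum_le_sum fun _ _ => norm_add_le _ _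

theorem l1_smul (z : ℂ) (v : FinVec n) : l1 (z • v) = ‖z‖ * l1 v := by
  rw [l1_eq_sum (s := v.support) Finsupp.support_smul, l1_eq_sum (Finset.Subset.refl _),
    Finset.mul_sum]
  simp

theorem l1_sum_le {ι : Type*} (s : Finset ι) (v : ι → FinVec n) :
    l1 (∑ i ∈ s, v i) ≤ ∑ i ∈ s, l1 (v i) :=
  Finset.le_sum_of_subadditive l1 l1_zero.le l1_add_le s v

theorem eq_sum_smul_numVec (v : FinVec n) : v = ∑ p ∈ v.support, v p • numVec p := by
  conv_lhs => rw [← Finsupp.sum_single v]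
  simp [Finsupp.sum]

theorem apply_eq_sum (X : Module.End ℂ (FinVec n)) (v : FinVec n) :
    X v = ∑ p ∈ v.support, v p • X (numVec p) := by
  conv_lhs => rw [eq_sum_smul_numVec v]
  simp only [map_sum, map_smul]

theorem l1_apply_le (X : Module.End ℂ (FinVec n)) (v : FinVec n) :
    l1 (X v) ≤ ∑ p ∈ v.support, ‖v p‖ * l1 (X (numVec p)) := by
  rw [apply_eq_sum X v]
  refine (l1_sum_le _ _).trans (Finset.sum_le_sum fun p _ => ?_)
  rw [l1_smul]

theorem l1_apply_le_mul {X : Module.End ℂ (FinVec n)} {v : FinVec n} {c : ℝ}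
    (h : ∀ p, v p ≠ 0 → l1 (X (numVec p)) ≤ c) : l1 (X v) ≤ l1 v * c := by
  refine (l1_apply_le X v).trans ?_
  rw [l1_eq_sum (Finset.Subset.refl _), Finset.sum_mul]
  exact Finset.sum_le_sum fun p hp =>
    mul_le_mul_of_nonneg_left (h p (Finsupp.mem_support_iff.1 hp)) (norm_nonneg _)

theorem norm_incl_le (v : FinVec n) : ‖incl n v‖ ≤ l1 v := by
  rw [incl, Finsupp.linearCombination_apply, Finsupp.sum, l1, Finsupp.sum]
  refine (norm_sum_le _ _).trans (Finset.sum_le_sum fun p _ => ?_)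
  rw [norm_smul, lp.norm_single (by norm_num)]
  simp

theorem norm_incl_numVec (k : Occ n) : ‖incl n (numVec k)‖ = 1 := by
  rw [incl, Finsupp.linearCombination_single, one_smul, lp.norm_single (by norm_num)]
  simp

/-! ### Order of a polynomial in ladder operators -/

/-- The square root of the total number plus one, which a ladder operator is bounded by. -/
def wt (k : Occ n) : ℝ := Real.sqrt (level k + 1)

theorem level_nonneg' (k : Occ n) : (0 : ℝ) ≤ level k := by exact_mod_cast level_nonneg k

theorem one_le_wt (k : Occ n) : 1 ≤ wt k := by
  rw [wt, Real.one_le_sqrt]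
  linarith [level_nonneg' k]

theorem wt_pos (k : Occ n) : 0 < wt k := zero_lt_one.trans_le (one_le_wt k)

theorem wt_sq (k : Occ n) : wt k ^ 2 = level k + 1 :=
  Real.sq_sqrt (by linarith [level_nonneg' k])

theorem wt_le_mul_wt {k l : Occ n} {B : ℝ} (hB : 0 ≤ B)
    (h : |((level l : ℝ) - level k)| ≤ B) : wt l ≤ Real.sqrt (1 + B) * wt k := by
  rw [wt, wt, ← Real.sqrt_mul (by positivity)]
  apply Real.sqrt_le_sqrt
  have := (abs_le.1 h).2
  nlinarith [level_nonneg' k]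

/-- The operator changes the total number by a bounded amount and is bounded by a multiple of
the `d`-th power of `wt`. -/
def HasOrder (d : ℕ) (X : Module.End ℂ (FinVec n)) : Prop :=
  ∃ c B : ℝ, 0 ≤ c ∧ 0 ≤ B ∧ ∀ k, l1 (X (numVec k)) ≤ c * wt k ^ d ∧
    ∀ l, X (numVec k) l ≠ 0 → |((level l : ℝ) - level k)| ≤ B

namespace HasOrder

variable {X Y : Module.End ℂ (FinVec n)} {d e : ℕ}

theorem add (hX : HasOrder d X) (hY : HasOrder d Y) : HasOrder d (X + Y) := by
  obtain ⟨c, B, hc, hB, h⟩ := hX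
  obtain ⟨c', B', hc', hB', h'⟩ := hY
  refine ⟨c + c', max B B', by positivity, by positivity, fun k => ⟨?_, fun l hl => ?_⟩⟩
  · rw [LinearMap.add_apply, add_mul]
    exact (l1_add_le _ _).trans (add_le_add (h k).1 (h' k).1)
  · by_cases h0 : X (numVec k) l = 0
    · refine ((h' k).2 l fun h1 => hl ?_).trans (le_max_right _ _)
      simp [LinearMap.add_apply, h0, h1]
    · exact ((h k).2 l h0).trans (le_max_left _ _)

theorem smul (hX : HasOrder d X) (z : ℂ) : HasOrder d (z • X) := by
  obtain ⟨c, B, hc, hB, h⟩ := hX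
  refine ⟨‖z‖ * c, B, by positivity, hB, fun k => ⟨?_, fun l hl => ?_⟩⟩
  · rw [LinearMap.smul_apply, l1_smul, mul_assoc]
    exact mul_le_mul_of_nonneg_left (h k).1 (norm_nonneg _)
  · refine (h k).2 l fun h1 => hl ?_
    simp [LinearMap.smul_apply, h1]

theorem zero : HasOrder d (0 : Module.End ℂ (FinVec n)) :=
  ⟨0, 0, le_rfl, le_rfl, fun k => ⟨by simp, fun l hl => by simp at hl⟩⟩

theorem one : HasOrder 0 (1 : Module.End ℂ (FinVec n)) := by
  refine ⟨1, 0, zero_le_one, le_rfl, fun k => ⟨?_, fun l hl => ?_⟩⟩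
  · have := l1_smul_numVec k 1
    rw [one_smul] at this
    simp [this]
  · have : k = l := by
      by_contra hkl
      simp [hkl] at hl
    simp [this]

theorem mul (hX : HasOrder d X) (hY : HasOrder e Y) : HasOrder (d + e) (X * Y) := by
  obtain ⟨c, B, hc, hB, h⟩ := hX
  obtain ⟨c', B', hc', hB', h'⟩ := hY
  -- The factor `Real.sqrt (1 + B') ^ d` pays for evaluating `wt` at the numbers that `Y` reaches,
  -- at most `B'` away from that of `k`.
  refine ⟨c' * (c * Real.sqrt (1 + B') ^ d), B + B', by positivity, by positivity,
    fun k => ⟨?_, fun l hl => ?_⟩⟩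
  · rw [Module.End.mul_apply]
    refine (l1_apply_le_mul (c := c * (Real.sqrt (1 + B') * wt k) ^ d) fun p hp => ?_).trans ?_
    · refine (h p).1.trans (mul_le_mul_of_nonneg_left ?_ hc)
      exact pow_le_pow_left₀ (wt_pos p).le (wt_le_mul_wt hB' ((h' k).2 p hp)) d
    · have hw := (wt_pos k).le
      refine (mul_le_mul_of_nonneg_right (h' k).1 (by positivity)).trans_eq ?_
      ring
  · rw [Module.End.mul_apply, apply_eq_sum, Finsupp.finsetSum_apply] at hl
    obtain ⟨p, hp, hpl⟩ := Finset.exists_ne_zero_of_sum_ne_zero hl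
    have h1 := (h' k).2 p (Finsupp.mem_support_iff.1 hp)
    have h2 := (h p).2 l fun h0 => hpl (by simp [h0])
    have := abs_add_le ((level l : ℝ) - level p) ((level p : ℝ) - level k)
    rw [sub_add_sub_cancel] at this
    linarith

theorem sum {ι : Type*} (s : Finset ι) {X : ι → Module.End ℂ (FinVec n)}
    (h : ∀ i, HasOrder d (X i)) : HasOrder d (∑ i ∈ s, X i) := by
  classical
  induction s using Finset.induction_on with
  | empty => simpa using zero
  | insert a s ha ih => rw [Finset.sum_insert ha]; exact (h a).add ih

end HasOrder

theorem cast_le_level (k : Occ n) (i : Fin n) : (k i : ℤ) ≤ level k :=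
  Finset.single_le_sum (f := fun i => (k i : ℤ)) (fun _ _ => by positivity) (Finset.mem_univ i)

theorem hasOrder_ladder (i : Idx n) : HasOrder 1 (ladder i : Module.End ℂ (FinVec n)) := by
  refine ⟨1, 1, zero_le_one, zero_le_one, fun k => ?_⟩
  rcases i with i | i
  · have hk : (k i : ℝ) ≤ level k := by exact_mod_cast cast_le_level k i
    simp only [ladder, Sum.elim_inl]
    rw [annihilation_numVec']
    refine ⟨?_, fun l hl => ?_⟩
    · rw [l1_smul_numVec, Complex.norm_real, Real.norm_of_nonneg (Real.sqrt_nonneg _), pow_one,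
        one_mul, wt]
      exact Real.sqrt_le_sqrt (by linarith)
    · by_cases h0 : k i = 0
      · simp [h0] at hl
      · have : k - Pi.single i 1 = l := by
          by_contra hkl
          simp [hkl] at hl
        rw [← this, level_sub_single h0]
        simp
  · have hk : (k i : ℝ) ≤ level k := by exact_mod_cast cast_le_level k i
    simp only [ladder, Sum.elim_inr]
    rw [creation_numVec']
    refine ⟨?_, fun l hl => ?_⟩
    · rw [l1_smul_numVec, Complex.norm_real, Real.norm_of_nonneg (Real.sqrt_nonneg _), pow_one,
        one_mul, wt]
      exact Real.sqrt_le_sqrt (by linarith)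
    · have : k + Pi.single i 1 = l := by
        by_contra hkl
        simp [hkl] at hl
      rw [← this, level_add_single]
      simp

theorem hasOrder_word (p : Idx n × Idx n) :
    HasOrder 2 (ladder p.1 * ladder p.2 : Module.End ℂ (FinVec n)) :=
  (hasOrder_ladder p.1).mul (hasOrder_ladder p.2)

theorem hasOrder_monomial {m : ℕ} (I : Fin m → Idx n) : HasOrder m (monomial I) := by
  induction m with
  | zero => rw [monomial_zero]; exact HasOrder.one
  | succ m ih =>
    rw [monomial_succ]
    have := (hasOrder_ladder (I 0)).mul (ih fun l => I l.succ)
    rwa [add_comm 1 m] at this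

theorem hasOrder_monomialAdj {m : ℕ} (I : Fin m → Idx n) : HasOrder m (monomialAdj I) :=
  hasOrder_monomial _

/-! ### Commutators -/

/-- The commutator of operators on the finite-particle space. -/
abbrev comm (X Y : Module.End ℂ (FinVec n)) : Module.End ℂ (FinVec n) := X * Y - Y * X

theorem commutator_mul_mul {A : Type*} [Ring A] (a b c d : A) :
    a * b * (c * d) - c * d * (a * b) =
      a * (b * c - c * b) * d + (a * c - c * a) * b * d + c * a * (b * d - d * b)
        + c * (a * d - d * a) * b := by noncomm_ring

/-- Each term of the commutator contracts one pair of ladder operators to a scalar, so the order is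
2 and not 4. Without this gain, first differences of `f` would enter the dissipator multiplied by N²
instead of N. -/
theorem hasOrder_word_commutator (p q : Idx n × Idx n) :
    HasOrder 2 (ladder p.1 * ladder p.2 * (ladder q.1 * ladder q.2)
      - ladder q.1 * ladder q.2 * (ladder p.1 * ladder p.2) : Module.End ℂ (FinVec n)) := by
  rw [commutator_mul_mul]
  simp only [ladder_comm, mul_smul_comm, smul_mul_assoc, mul_one, one_mul]
  exact ((((hasOrder_word (p.1, q.2)).smul _).add ((hasOrder_word (p.2, q.2)).smul _)).add
    ((hasOrder_word (q.1, p.1)).smul _)).add ((hasOrder_word (q.1, p.2)).smul _)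

/-- Finite difference. -/
def diff (a : ℤ) (f : ℤ → ℝ) (x : ℤ) : ℝ := f x - f (x + a)

theorem word_commutator_diag (p : Idx n × Idx n) (f : ℤ → ℝ) :
    ladder p.1 * ladder p.2 * diag f - diag f * (ladder p.1 * ladder p.2) =
      ladder p.1 * ladder p.2 * diag (diff (shift p.1 + shift p.2) f) := by
  have : (diag (diff (shift p.1 + shift p.2) f) : Module.End ℂ (FinVec n)) =
      diag f - diag (fun x => f (x + (shift p.1 + shift p.2))) := diag_sub f _
  rw [this, diag_mul_word, mul_sub]

/-- Leibniz's rule [v, wg] = [v,w]g + w[v,g]. In the application `v`, `w` are words and `f`, `g`,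
`h` are a function of the total number and its first and second differences. -/
theorem double_commutator_of_commutator {A : Type*} [Ring A] {v w f g h : A}
    (hw : w * f - f * w = w * g) (hv : v * g - g * v = v * h) :
    v * (w * f - f * w) - (w * f - f * w) * v = (v * w - w * v) * g + w * v * h := by
  rw [hw, mul_assoc w v h, ← hv]
  noncomm_ring

theorem word_double_commutator_diag (p q : Idx n × Idx n) (f : ℤ → ℝ) :
    ladder p.1 * ladder p.2 *
        (ladder q.1 * ladder q.2 * diag f - diag f * (ladder q.1 * ladder q.2))
      - (ladder q.1 * ladder q.2 * diag f - diag f * (ladder q.1 * ladder q.2)) *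
        (ladder p.1 * ladder p.2) =
    (ladder p.1 * ladder p.2 * (ladder q.1 * ladder q.2)
      - ladder q.1 * ladder q.2 * (ladder p.1 * ladder p.2)) *
        diag (diff (shift q.1 + shift q.2) f)
      + ladder q.1 * ladder q.2 * (ladder p.1 * ladder p.2) *
        diag (diff (shift p.1 + shift p.2) (diff (shift q.1 + shift q.2) f)) :=
  double_commutator_of_commutator (word_commutator_diag q f) (word_commutator_diag p _)

theorem quadOp_eq_sum (K : Matrix (Idx n) (Idx n) ℂ) :
    quadOp K = ∑ p : Idx n × Idx n, (K p.1 p.2 / 2) • (ladder p.1 * ladder p.2) := by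
  rw [quadOp, Fintype.sum_prod_type, Finset.smul_sum]
  refine Finset.sum_congr rfl fun i _ => ?_
  rw [Finset.smul_sum]
  refine Finset.sum_congr rfl fun j _ => ?_
  rw [smul_smul]
  congr 1
  ring

theorem sum_smul_commutator {A ι : Type*} [Ring A] [Algebra ℂ A] (s : Finset ι) (c : ι → ℂ)
    (x : ι → A) (y : A) :
    (∑ i ∈ s, c i • x i) * y - y * ∑ i ∈ s, c i • x i = ∑ i ∈ s, c i • (x i * y - y * x i) := by
  simp only [Finset.sum_mul, Finset.mul_sum, ← Finset.sum_sub_distrib, smul_mul_assoc,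
    mul_smul_comm, smul_sub]

theorem sum_smul_double_commutator {A ι : Type*} [Ring A] [Algebra ℂ A] (s : Finset ι) (c : ι → ℂ)
    (x : ι → A) (y : A) :
    (∑ i ∈ s, c i • x i) * ((∑ i ∈ s, c i • x i) * y - y * ∑ i ∈ s, c i • x i)
      - ((∑ i ∈ s, c i • x i) * y - y * ∑ i ∈ s, c i • x i) * ∑ i ∈ s, c i • x i =
    ∑ i ∈ s, ∑ j ∈ s, (c i * c j) • (x i * (x j * y - y * x j) - (x j * y - y * x j) * x i) := by
  rw [sum_smul_commutator s c x (_ - _), sum_smul_commutator s c x y]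
  refine Finset.sum_congr rfl fun i _ => ?_
  simp only [Finset.sum_mul, Finset.mul_sum, ← Finset.sum_sub_distrib, smul_mul_assoc,
    mul_smul_comm, ← smul_sub, Finset.smul_sum, smul_smul]

theorem abs_shift_add_le (p : Idx n × Idx n) : |shift p.1 + shift p.2| ≤ 2 := by
  rcases p with ⟨i | i, j | j⟩ <;> simp [shift]

theorem HasOrder.l1_mul_diag {X : Module.End ℂ (FinVec n)} {d : ℕ} (hX : HasOrder d X) :
    ∃ c, 0 ≤ c ∧ ∀ (f : ℤ → ℝ) (k : Occ n),
      l1 ((X * diag f : Module.End ℂ (FinVec n)) (numVec k)) ≤ c * (wt k ^ d * |f (level k)|) := by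
  obtain ⟨c, B, hc, hB, h⟩ := hX
  refine ⟨c, hc, fun f k => ?_⟩
  rw [Module.End.mul_apply, diag_numVec, map_smul, l1_smul, Complex.norm_real, Real.norm_eq_abs,
    mul_comm, ← mul_assoc]
  exact mul_le_mul_of_nonneg_right (h k).1 (abs_nonneg _)

/-- Bound on `Z [C, f(N)]` by the first differences of `f`. -/
theorem HasOrder.exists_l1_mul_commutator_diag_le {Z : Module.End ℂ (FinVec n)} {d : ℕ}
    (hZ : HasOrder d Z) (K : Matrix (Idx n) (Idx n) ℂ) :
    ∃ c, 0 ≤ c ∧ ∀ (f : ℤ → ℝ) (k : Occ n) (h : ℝ),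
      (∀ a : ℤ, |a| ≤ 2 → ((level k : ℝ) + 1) * |diff a f (level k)| ≤ h) →
      l1 ((Z * comm (quadOp K) (diag f) : Module.End ℂ (FinVec n)) (numVec k)) ≤
        c * (wt k ^ d * h) := by
  choose c hc hcb using fun p : Idx n × Idx n => (hZ.mul (hasOrder_word p)).l1_mul_diag
  refine ⟨∑ p : Idx n × Idx n, ‖K p.1 p.2 / 2‖ * c p,
    Finset.sum_nonneg fun p _ => mul_nonneg (norm_nonneg _) (hc p), fun f k h hf => ?_⟩
  rw [comm, quadOp_eq_sum, sum_smul_commutator, Finset.mul_sum, LinearMap.sum_apply,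
    Finset.sum_mul]
  refine (l1_sum_le _ _).trans (Finset.sum_le_sum fun p _ => ?_)
  rw [mul_smul_comm, LinearMap.smul_apply, l1_smul, word_commutator_diag, ← mul_assoc Z,
    mul_assoc ‖_‖]
  refine mul_le_mul_of_nonneg_left ((hcb p _ k).trans ?_) (norm_nonneg _)
  refine mul_le_mul_of_nonneg_left ?_ (hc p)
  -- The word of length two contributes `wt k ^ 2`, which is the factor `level k + 1` in front of
  -- the first difference.
  rw [pow_add, wt_sq, mul_assoc]
  exact mul_le_mul_of_nonneg_left (hf _ (abs_shift_add_le p)) (pow_nonneg (wt_pos k).le d)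

/-- Bound on `Z [C, [C, f(N)]]` by the first and second differences of `f`. -/
theorem HasOrder.exists_l1_mul_double_commutator_diag_le {Z : Module.End ℂ (FinVec n)} {d : ℕ}
    (hZ : HasOrder d Z) (K : Matrix (Idx n) (Idx n) ℂ) :
    ∃ c, 0 ≤ c ∧ ∀ (f : ℤ → ℝ) (k : Occ n) (h : ℝ),
      (∀ a : ℤ, |a| ≤ 2 → ((level k : ℝ) + 1) * |diff a f (level k)| ≤ h) →
      (∀ a b : ℤ, |a| ≤ 2 → |b| ≤ 2 →
        ((level k : ℝ) + 1) ^ 2 * |diff a (diff b f) (level k)| ≤ h) →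
      l1 ((Z * comm (quadOp K) (comm (quadOp K) (diag f)) : Module.End ℂ (FinVec n))
        (numVec k)) ≤ c * (wt k ^ d * h) := by
  choose c hc hcb using fun r : (Idx n × Idx n) × (Idx n × Idx n) =>
    (hZ.mul (hasOrder_word_commutator r.1 r.2)).l1_mul_diag
  choose c' hc' hcb' using fun r : (Idx n × Idx n) × (Idx n × Idx n) =>
    (hZ.mul ((hasOrder_word r.2).mul (hasOrder_word r.1))).l1_mul_diag
  refine ⟨∑ p : Idx n × Idx n, ∑ q : Idx n × Idx n,
      ‖K p.1 p.2 / 2 * (K q.1 q.2 / 2)‖ * (c (p, q) + c' (p, q)),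
    Finset.sum_nonneg fun p _ => Finset.sum_nonneg fun q _ =>
      mul_nonneg (norm_nonneg _) (add_nonneg (hc _) (hc' _)), fun f k h hf hf' => ?_⟩
  have hw := pow_nonneg (wt_pos k).le d
  rw [comm, comm, quadOp_eq_sum, sum_smul_double_commutator, Finset.mul_sum,
    LinearMap.sum_apply, Finset.sum_mul]
  refine (l1_sum_le _ _).trans (Finset.sum_le_sum fun p _ => ?_)
  rw [Finset.mul_sum, LinearMap.sum_apply, Finset.sum_mul]
  refine (l1_sum_le _ _).trans (Finset.sum_le_sum fun q _ => ?_)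
  rw [mul_smul_comm, LinearMap.smul_apply, l1_smul, word_double_commutator_diag, mul_add,
    ← mul_assoc Z, ← mul_assoc Z, mul_assoc ‖_‖]
  refine mul_le_mul_of_nonneg_left ?_ (norm_nonneg _)
  rw [LinearMap.add_apply, add_mul]
  refine (l1_add_le _ _).trans (add_le_add ?_ ?_)
  · refine (hcb (p, q) _ k).trans (mul_le_mul_of_nonneg_left ?_ (hc _))
    rw [pow_add, wt_sq, mul_assoc]
    exact mul_le_mul_of_nonneg_left (hf _ (abs_shift_add_le q)) hw
  · refine (hcb' (p, q) _ k).trans (mul_le_mul_of_nonneg_left ?_ (hc' _))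
    rw [pow_add, pow_add, wt_sq, ← sq, mul_assoc]
    exact mul_le_mul_of_nonneg_left
      (hf' _ _ (abs_shift_add_le p) (abs_shift_add_le q)) hw

/-! ### Commutators of quadratic operators with words -/

/-- The two contractions of `ladder l` with a word of length two give equal sums because `K` is
symmetric; this cancels the ½ in `quadOp`. -/
theorem quadOp_commutator_ladder {K : Matrix (Idx n) (Idx n) ℂ} (hs : Kᵀ = K) (l : Idx n) :
    quadOp K * ladder l - ladder l * quadOp K =
      ∑ i, (Matrix.J (Fin n) ℂ * K) l i • ladder i := by
  have hJ : ∀ i j, Matrix.J (Fin n) ℂ i j = -Matrix.J (Fin n) ℂ j i := fun i j => by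
    conv_lhs => rw [← neg_neg (Matrix.J (Fin n) ℂ), ← Matrix.J_transpose]
    rfl
  have hK : ∀ i j, K i j = K j i := fun i j => by
    conv_lhs => rw [← hs]
    rfl
  have key : ∀ i j, ladder i * ladder j * ladder l - ladder l * (ladder i * ladder j) =
      Matrix.J (Fin n) ℂ l j • ladder i + Matrix.J (Fin n) ℂ l i • ladder j := fun i j => by
    have : ladder i * ladder j * ladder l - ladder l * (ladder i * ladder j) =
        ladder i * (ladder j * ladder l - ladder l * ladder j) +
        (ladder i * ladder l - ladder l * ladder i) * ladder (n := n) j := by noncomm_ring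
    rw [this, ladder_comm, ladder_comm, ← hJ, ← hJ]
    simp
  rw [quadOp_eq_sum, sum_smul_commutator]
  simp only [key, Fintype.sum_prod_type, smul_add, smul_smul, Finset.sum_add_distrib]
  conv_lhs => enter [2]; rw [Finset.sum_comm]
  rw [← Finset.sum_add_distrib]
  refine Finset.sum_congr rfl fun i _ => ?_
  rw [← Finset.sum_add_distrib, Matrix.mul_apply, Finset.sum_smul]
  refine Finset.sum_congr rfl fun j _ => ?_
  rw [← add_smul, hK i j]
  congr 1
  ring

theorem kroneckerProd_succ {m : ℕ} (A : Fin (m + 1) → Matrix (Idx n) (Idx n) ℂ)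
    (I I' : Fin (m + 1) → Idx n) :
    kroneckerProd A I I' = A 0 (I 0) (I' 0) *
      kroneckerProd (fun l => A l.succ) (fun l => I l.succ) (fun l => I' l.succ) := by
  simp [kroneckerProd, Fin.prod_univ_succ]

theorem kroneckerProd_one {m : ℕ} :
    kroneckerProd (fun _ : Fin m => (1 : Matrix (Idx n) (Idx n) ℂ)) = 1 := by
  ext I I'
  simp only [kroneckerProd, Matrix.of_apply, Matrix.one_apply]
  rw [Finset.prod_ite_zero]
  simp [funext_iff]

theorem kroneckerProd_mul {m : ℕ} (A B : Fin m → Matrix (Idx n) (Idx n) ℂ) :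
    kroneckerProd A * kroneckerProd B = kroneckerProd (fun l => A l * B l) := by
  ext I I'
  simp only [kroneckerProd, Matrix.of_apply, Matrix.mul_apply, ← Finset.prod_mul_distrib]
  rw [Finset.prod_univ_sum, Fintype.piFinset_univ]

/-- The derivation `∑_l 1 ⊗ ⋯ ⊗ M ⊗ ⋯ ⊗ 1` of the tensor power induced by a matrix `M`. -/
def derivMat (m : ℕ) (M : Matrix (Idx n) (Idx n) ℂ) :
    Matrix (Fin m → Idx n) (Fin m → Idx n) ℂ :=
  ∑ i : Fin m, kroneckerProd fun l => M ^ (if i = l then 1 else 0)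

/-- Kronecker products multiply slot by slot, so the exponents add; this is the form of the
generator in the final formula. -/
theorem derivMat_mul_self (m : ℕ) (M : Matrix (Idx n) (Idx n) ℂ) :
    derivMat m M * derivMat m M = ∑ i : Fin m, ∑ p : Fin m,
      kroneckerProd fun l => M ^ ((if i = l then 1 else 0) + (if p = l then 1 else 0)) := by
  simp only [derivMat, Finset.sum_mul, Finset.mul_sum, kroneckerProd_mul, pow_add]
  exact Finset.sum_comm

theorem derivMat_succ {m : ℕ} (M : Matrix (Idx n) (Idx n) ℂ) (I I' : Fin (m + 1) → Idx n) :
    derivMat (m + 1) M I I' =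
      M (I 0) (I' 0) * (1 : Matrix (Fin m → Idx n) (Fin m → Idx n) ℂ)
        (fun l => I l.succ) (fun l => I' l.succ) +
      (1 : Matrix (Idx n) (Idx n) ℂ) (I 0) (I' 0) *
        derivMat m M (fun l => I l.succ) (fun l => I' l.succ) := by
  simp only [derivMat, Fin.sum_univ_succ, Matrix.sum_apply,
    kroneckerProd_succ, Finset.mul_sum]
  simp [(Fin.succ_ne_zero _).symm, kroneckerProd_one]

/-- Leibniz's rule, by induction on the first slot. The length of the words does not grow, which is
why the moment equations of order `m` close. -/
theorem quadOp_commutator_monomial {m : ℕ} {K : Matrix (Idx n) (Idx n) ℂ} (hs : Kᵀ = K)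
    (I : Fin m → Idx n) :
    comm (quadOp K) (monomial I) =
      ∑ I', derivMat m (Matrix.J (Fin n) ℂ * K) I I' • monomial I' := by
  induction m with
  | zero => simp [comm, monomial_zero, derivMat]
  | succ m ih =>
    have : comm (quadOp K) (monomial I) =
        (quadOp K * ladder (I 0) - ladder (I 0) * quadOp K) * monomial (fun l => I l.succ) +
        ladder (I 0) * comm (quadOp K) (monomial (fun l => I l.succ)) := by
      rw [comm, comm, monomial_succ]; noncomm_ring
    rw [this, quadOp_commutator_ladder hs, ih,
      ← (Fin.consEquiv (fun _ : Fin (m + 1) => Idx n)).sum_comp, Fintype.sum_prod_type]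
    simp only [derivMat_succ, monomial_succ, Fin.consEquiv_apply, Fin.cons_zero, Fin.cons_succ,
      add_smul, Finset.sum_add_distrib]
    congr 1
    · rw [Finset.sum_mul]
      refine Finset.sum_congr rfl fun i _ => ?_
      simp [Matrix.one_apply]
    · rw [Finset.sum_comm, Finset.mul_sum]
      refine Finset.sum_congr rfl fun I' _ => ?_
      simp [Matrix.one_apply]

/-! ### Operators with finitely many nonzero columns and their traces -/

/-- The operator vanishes on all but finitely many number vectors. -/
def IsFin (X : Module.End ℂ (FinVec n)) : Prop := {k | X (numVec k) ≠ 0}.Finite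

/-- The trace `tr (ρ X)`. -/
def tr (ρ : Fock n →L[ℂ] Fock n) (X : Module.End ℂ (FinVec n)) : ℂ :=
  ∑' k, ⟪incl n (numVec k), ρ (incl n (X (numVec k)))⟫_ℂ

namespace IsFin

variable {X Y : Module.End ℂ (FinVec n)}

theorem exists_finset (h : IsFin X) : ∃ s : Finset (Occ n), ∀ k ∉ s, X (numVec k) = 0 :=
  ⟨h.toFinset, fun _ hk => by_contra fun h0 => hk (h.mem_toFinset.2 h0)⟩

theorem of_finset (s : Finset (Occ n)) (h : ∀ k ∉ s, X (numVec k) = 0) : IsFin X :=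
  s.finite_toSet.subset fun k hk => by
    by_contra hks
    exact hk (h k hks)

theorem add (hX : IsFin X) (hY : IsFin Y) : IsFin (X + Y) :=
  (hX.union hY).subset fun k hk => by
    by_contra h
    simp only [Set.mem_union, Set.mem_ofPred_eq, not_or, not_not] at h
    exact hk (by simp [LinearMap.add_apply, h.1, h.2])

theorem smul (hX : IsFin X) (z : ℂ) : IsFin (z • X) :=
  hX.subset fun k hk h => hk (by rw [LinearMap.smul_apply, h, smul_zero])

theorem sub (hX : IsFin X) (hY : IsFin Y) : IsFin (X - Y) := by
  have := hX.add (hY.smul (-1))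
  rwa [neg_one_smul, ← sub_eq_add_neg] at this

theorem zero : IsFin (0 : Module.End ℂ (FinVec n)) := by simp [IsFin]

theorem sum {ι : Type*} (s : Finset ι) {X : ι → Module.End ℂ (FinVec n)}
    (h : ∀ i, IsFin (X i)) : IsFin (∑ i ∈ s, X i) := by
  classical
  induction s using Finset.induction_on with
  | empty => simpa using zero
  | insert a s ha ih => rw [Finset.sum_insert ha]; exact (h a).add ih

theorem mul_left (hX : IsFin X) (Y : Module.End ℂ (FinVec n)) : IsFin (Y * X) :=
  hX.subset fun k hk h => hk (by rw [Module.End.mul_apply, h, map_zero])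

/-- The adjoint makes the rows of the matrix of `Y` finite, so only finitely many columns of `Y`
meet the finitely many columns on which `X` is nonzero. -/
theorem mul_right (hX : IsFin X) (hY : ∃ Y', IsAdj Y Y') : IsFin (X * Y) := by
  classical
  obtain ⟨Y', hY⟩ := hY
  obtain ⟨s, hs⟩ := hX.exists_finset
  refine of_finset (s.biUnion fun k => (Y' (numVec k)).support) fun l hl => ?_
  rw [Module.End.mul_apply, apply_eq_sum]
  refine Finset.sum_eq_zero fun k hk => ?_
  by_cases hks : k ∈ s
  · exfalso
    refine hl (Finset.mem_biUnion.2 ⟨k, hks, Finsupp.mem_support_iff.2 fun h0 => ?_⟩)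
    rw [Finsupp.mem_support_iff, hY.apply_eq, h0, map_zero] at hk
    exact hk rfl
  · rw [hs k hks, smul_zero]

theorem comm (hX : IsFin X) (hY : IsAdj Y Y) : IsFin (comm Y X) :=
  (hX.mul_left Y).sub (hX.mul_right ⟨Y, hY⟩)

theorem summable (hX : IsFin X) (F : Occ n → FinVec n →ₗ[ℂ] ℂ) :
    Summable fun k => F k (X (numVec k)) := by
  obtain ⟨s, hs⟩ := hX.exists_finset
  refine summable_of_ne_finset_zero (s := s) fun k hk => ?_
  rw [hs k hk, map_zero]

end IsFin

theorem finite_setOf_level_le (L : ℤ) : {k : Occ n | level k ≤ L}.Finite := by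
  refine (Set.finite_Iic (fun _ : Fin n => L.toNat)).subset fun k hk i => ?_
  have := cast_le_level k i
  have hk' : level k ≤ L := hk
  show k i ≤ L.toNat
  omega

theorem isFin_diag {f : ℤ → ℝ} {L : ℤ} (hf : ∀ x, L < x → f x = 0) :
    IsFin (diag f : Module.End ℂ (FinVec n)) := by
  refine (finite_setOf_level_le L).subset fun k hk => ?_
  by_contra h
  refine hk ?_
  rw [diag_numVec, hf _ (not_le.1 h)]
  simp

/-- The linear form `v ↦ ⟨φ, ρ v⟩`. -/
def form (ρ : Fock n →L[ℂ] Fock n) (φ : FinVec n) : FinVec n →ₗ[ℂ] ℂ where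
  toFun v := ⟪incl n φ, ρ (incl n v)⟫_ℂ
  map_add' v w := by simp only [map_add, inner_add_right]
  map_smul' c v := by simp only [map_smul, inner_smul_right, smul_eq_mul, RingHom.id_apply]

theorem tr_eq_sum {ρ : Fock n →L[ℂ] Fock n} {X : Module.End ℂ (FinVec n)} {s : Finset (Occ n)}
    (hs : ∀ k ∉ s, X (numVec k) = 0) :
    tr ρ X = ∑ k ∈ s, ⟪incl n (numVec k), ρ (incl n (X (numVec k)))⟫_ℂ :=
  tsum_eq_sum fun k hk => by rw [hs k hk]; simp

section tr

variable {X Y : Module.End ℂ (FinVec n)} (ρ : Fock n →L[ℂ] Fock n)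

theorem tr_add (hX : IsFin X) (hY : IsFin Y) : tr ρ (X + Y) = tr ρ X + tr ρ Y := by
  have := (hX.summable fun k => form ρ (numVec k)).tsum_add
    (hY.summable fun k => form ρ (numVec k))
  simp only [← map_add] at this
  exact this

theorem tr_smul (z : ℂ) : tr ρ (z • X) = z * tr ρ X := by
  rw [tr, tr, ← tsum_mul_left]
  exact tsum_congr fun k => map_smul (form ρ (numVec k)) _ _

theorem tr_sub (hX : IsFin X) (hY : IsFin Y) : tr ρ (X - Y) = tr ρ X - tr ρ Y := by
  rw [sub_eq_add_neg, ← neg_one_smul ℂ Y, tr_add ρ hX (hY.smul _), tr_smul]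
  ring

theorem tr_zero : tr ρ (0 : Module.End ℂ (FinVec n)) = 0 := by simp [tr]

theorem tr_sum {ι : Type*} (s : Finset ι) {X : ι → Module.End ℂ (FinVec n)}
    (h : ∀ i, IsFin (X i)) : tr ρ (∑ i ∈ s, X i) = ∑ i ∈ s, tr ρ (X i) := by
  classical
  induction s using Finset.induction_on with
  | empty => simpa using tr_zero ρ
  | insert a s ha ih =>
    rw [Finset.sum_insert ha, Finset.sum_insert ha, tr_add ρ (h a) (IsFin.sum s h), ih]

theorem inner_incl_eq_sum {φ : FinVec n} {s : Finset (Occ n)} (hs : φ.support ⊆ s) (v : Fock n) :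
    ⟪incl n φ, v⟫_ℂ = ∑ l ∈ s, starRingEnd ℂ (φ l) * ⟪incl n (numVec l), v⟫_ℂ := by
  have : φ = ∑ l ∈ s, φ l • numVec l := by
    conv_lhs => rw [eq_sum_smul_numVec φ]
    refine Finset.sum_subset hs fun l _ hl => ?_
    rw [Finsupp.notMem_support_iff.1 hl, zero_smul]
  conv_lhs => rw [this]
  simp only [map_sum, map_smul, sum_inner, inner_smul_left]

/-- Cyclicity of the trace. -/
theorem tsum_inner_adj {C C' : Module.End ℂ (FinVec n)} (hY : IsFin Y) (hC : IsAdj C C') :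
    ∑' k, ⟪incl n (C' (numVec k)), ρ (incl n (Y (numVec k)))⟫_ℂ = tr ρ (Y * C) := by
  classical
  obtain ⟨s, hs⟩ := hY.exists_finset
  set t := s.biUnion fun k => (C' (numVec k)).support with ht
  have hzero : ∀ k l, k ∈ s → l ∉ t → C (numVec l) k = 0 := fun k l hk hl => by
    rw [hC.apply_eq]
    have : C' (numVec k) l = 0 := by
      by_contra h0
      exact hl (Finset.mem_biUnion.2 ⟨k, hk, Finsupp.mem_support_iff.2 h0⟩)
    rw [this, map_zero]
  -- The support of `C (numVec l)` may be traded for the fixed set `s`, since `Y` vanishes off `s`.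
  -- Both traces then become sums over `s` and `t`, and can be interchanged.
  have hexp : ∀ l, Y (C (numVec l)) = ∑ k ∈ s, C (numVec l) k • Y (numVec k) := fun l => by
    rw [apply_eq_sum Y, ← Finset.sum_inter_add_sum_sdiff _ s, Finset.inter_comm,
      ← Finset.sum_inter_add_sum_sdiff s (C (numVec l)).support]
    congr 1
    rw [Finset.sum_eq_zero, Finset.sum_eq_zero]
    · intro k hk
      rw [Finsupp.notMem_support_iff.1 (Finset.mem_sdiff.1 hk).2, zero_smul]
    · intro k hk
      rw [hs k (Finset.mem_sdiff.1 hk).2, smul_zero]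
  rw [tr_eq_sum (s := t), tsum_eq_sum (s := s)]
  · have h1 : ∀ k ∈ s, ⟪incl n (C' (numVec k)), ρ (incl n (Y (numVec k)))⟫_ℂ =
        ∑ l ∈ t, C (numVec l) k * ⟪incl n (numVec l), ρ (incl n (Y (numVec k)))⟫_ℂ :=
      fun k hk => by
        rw [inner_incl_eq_sum (s := t)
          (Finset.subset_biUnion_of_mem (fun k => (C' (numVec k)).support) hk)]
        exact Finset.sum_congr rfl fun l _ => by rw [hC.apply_eq]
    rw [Finset.sum_congr rfl h1, Finset.sum_comm]
    refine Finset.sum_congr rfl fun l _ => ?_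
    rw [Module.End.mul_apply, hexp]
    simp only [map_sum, map_smul, inner_sum, inner_smul_right]
  · intro k hk
    rw [hs k hk]
    simp
  · intro l hl
    rw [Module.End.mul_apply, hexp]
    exact Finset.sum_eq_zero fun k hk => by rw [hzero k l hk hl, zero_smul]

end tr

/-! ### The derivative of a trace -/

theorem double_commutator_eq {A : Type*} [Ring A] (c x : A) :
    c * (c * x - x * c) - (c * x - x * c) * c = x * (c * c) - (c * x * c + c * x * c)
      + c * (c * x) := by noncomm_ring

/-- The double commutator passes from the state to the observable: the factors `C` standing to the
left of `ρ` travel round the trace by `tsum_inner_adj`. -/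
theorem tsum_doubleCommElem {C X : Module.End ℂ (FinVec n)} (ρ : Fock n →L[ℂ] Fock n)
    (hC : IsAdj C C) (hX : IsFin X) :
    ∑' k, doubleCommElem C ρ (numVec k) (X (numVec k)) = tr ρ (comm C (comm C X)) := by
  have h2 := hC.mul hC
  have hf : ∀ {Y : Module.End ℂ (FinVec n)}, IsFin Y → ∀ F : Module.End ℂ (FinVec n),
      Summable fun k => ⟪incl n (F (numVec k)), ρ (incl n (Y (numVec k)))⟫_ℂ :=
    fun hY F => hY.summable fun k => form ρ (F (numVec k))
  have s1 := hf hX (C * C)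
  have s2 := hf (hX.mul_left C) C
  have s3 := hf ((hX.mul_left C).mul_left C) 1
  have e1 := tsum_inner_adj ρ hX h2
  have e2 := tsum_inner_adj ρ (hX.mul_left C) hC
  rw [comm, comm, double_commutator_eq, tr_add, tr_sub, tr_add, ← e1, ← e2]
  · have e3 : tr ρ (C * (C * X)) = ∑' k, ⟪incl n ((1 : Module.End ℂ (FinVec n)) (numVec k)),
        ρ (incl n ((C * (C * X)) (numVec k)))⟫_ℂ := rfl
    rw [e3, ← s2.tsum_add s2, ← s1.tsum_sub (s2.add s2), ← (s1.sub (s2.add s2)).tsum_add s3]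
    refine tsum_congr fun k => ?_
    simp only [doubleCommElem, Module.End.mul_apply, Module.End.one_apply]
    ring
  · exact (hX.mul_left C).mul_right ⟨C, hC⟩
  · exact (hX.mul_left C).mul_right ⟨C, hC⟩
  · exact hX.mul_right ⟨_, h2⟩
  · exact ((hX.mul_left C).mul_right ⟨C, hC⟩).add ((hX.mul_left C).mul_right ⟨C, hC⟩)
  · exact (hX.mul_right ⟨_, h2⟩).sub
      (((hX.mul_left C).mul_right ⟨C, hC⟩).add ((hX.mul_left C).mul_right ⟨C, hC⟩))
  · exact (hX.mul_left C).mul_left C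

/-- With finitely many nonzero columns the trace is a finite sum over a set that does not depend on
time, so the weak equation can be applied term by term. -/
theorem IsSolution.hasDerivWithinAt_tr {N : ℕ} {C : Fin N → Module.End ℂ (FinVec n)}
    {ρ : ℝ → (Fock n →L[ℂ] Fock n)} (hρ : IsSolution C ρ) (hC : ∀ j, IsAdj (C j) (C j))
    {X : Module.End ℂ (FinVec n)} (hX : IsFin X) {t : ℝ} (ht : 0 ≤ t) :
    HasDerivWithinAt (fun s => tr (ρ s) X)
      (-(1 / 2 : ℂ) * ∑ j, tr (ρ t) (comm (C j) (comm (C j) X))) (Set.Ici 0) t := by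
  obtain ⟨s, hs⟩ := hX.exists_finset
  have h1 : (fun r => tr (ρ r) X) =
      fun r => ∑ k ∈ s, ⟪incl n (numVec k), ρ r (incl n (X (numVec k)))⟫_ℂ :=
    funext fun r => tr_eq_sum hs
  have h2 : ∀ j, tr (ρ t) (comm (C j) (comm (C j) X)) =
      ∑ k ∈ s, doubleCommElem (C j) (ρ t) (numVec k) (X (numVec k)) := fun j => by
    rw [← tsum_doubleCommElem _ (hC j) hX]
    refine tsum_eq_sum fun k hk => ?_
    rw [hs k hk]
    simp [doubleCommElem]
  rw [h1, Finset.sum_congr rfl fun j _ => h2 j, Finset.sum_comm, Finset.mul_sum]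
  exact HasDerivWithinAt.fun_sum fun k _ => hρ.hasDeriv t ht (numVec k) (X (numVec k))

/-! ### Populations -/

/-- The population `⟨e_k, ρ e_k⟩`. -/
def pop (ρ : Fock n →L[ℂ] Fock n) (k : Occ n) : ℝ :=
  (⟪incl n (numVec k), ρ (incl n (numVec k))⟫_ℂ).re

namespace IsDensityMatrix

variable {ρ : Fock n →L[ℂ] Fock n} (hρ : IsDensityMatrix ρ)
include hρ

theorem pop_nonneg (k : Occ n) : 0 ≤ pop ρ k := hρ.isPositive.re_inner_nonneg_right _

theorem ofReal_pop (k : Occ n) :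
    ((pop ρ k : ℝ) : ℂ) = ⟪incl n (numVec k), ρ (incl n (numVec k))⟫_ℂ :=
  Complex.conj_eq_iff_re.1 (by
    rw [inner_conj_symm]
    exact hρ.isPositive.isSymmetric _ _)

theorem hasSum_pop : HasSum (pop ρ) 1 := Complex.hasSum_re hρ.trace_eq_one

/-- Positivity of `ρ` at x - cy, with the phase c chosen so that both cross terms equal -|⟨x, ρy⟩|.
The arithmetic mean is preferred to the geometric one because it is linear in the populations. -/
theorem norm_inner_le (x y : Fock n) :
    ‖⟪x, ρ y⟫_ℂ‖ ≤ ((⟪x, ρ x⟫_ℂ).re + (⟪y, ρ y⟫_ℂ).re) / 2 := by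
  obtain ⟨c, hc, hc'⟩ : ∃ c : ℂ, ‖c‖ = 1 ∧ c * ⟪x, ρ y⟫_ℂ = ‖⟪x, ρ y⟫_ℂ‖ := by
    obtain ⟨c, hc, h⟩ := RCLike.exists_norm_eq_mul_self (K := ℂ) ⟪x, ρ y⟫_ℂ
    exact ⟨c, hc, h.symm⟩
  have h := hρ.isPositive.re_inner_nonneg_right (x - c • y)
  have hyx : ⟪y, ρ x⟫_ℂ = starRingEnd ℂ ⟪x, ρ y⟫_ℂ := by
    rw [inner_conj_symm]
    exact (hρ.isPositive.isSymmetric _ _).symm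
  have hcc : starRingEnd ℂ c * (c * ⟪y, ρ y⟫_ℂ) = ⟪y, ρ y⟫_ℂ := by
    rw [← mul_assoc, mul_comm (starRingEnd ℂ c), Complex.mul_conj, Complex.normSq_eq_norm_sq, hc]
    simp
  have hcc' : c * (starRingEnd ℂ c * ⟪y, ρ y⟫_ℂ) = ⟪y, ρ y⟫_ℂ := by
    rw [mul_left_comm, hcc]
  have h2 : starRingEnd ℂ c * starRingEnd ℂ ⟪x, ρ y⟫_ℂ = ‖⟪x, ρ y⟫_ℂ‖ := by
    rw [← map_mul, hc', Complex.conj_ofReal]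
  simp only [map_sub, map_smul, inner_sub_left, inner_sub_right, inner_smul_left,
    inner_smul_right, hyx, mul_sub, hc', h2, hcc'] at h
  simp at h
  linarith

theorem norm_entry_le (k l : Occ n) :
    ‖⟪incl n (numVec k), ρ (incl n (numVec l))⟫_ℂ‖ ≤ (pop ρ k + pop ρ l) / 2 :=
  hρ.norm_inner_le _ _

/-- Schur's test for the trace against a density matrix. -/
theorem sum_sum_norm_le {X X' : Module.End ℂ (FinVec n)} (hX : IsAdj X X') {g : Occ n → ℝ}
    (h : ∀ k, l1 (X (numVec k)) ≤ g k) (h' : ∀ k, l1 (X' (numVec k)) ≤ g k)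
    (hg : Summable fun k => g k * pop ρ k) (s : Finset (Occ n)) :
    ∑ k ∈ s, ∑ l ∈ (X (numVec k)).support, ‖X (numVec k) l‖ * ((pop ρ k + pop ρ l) / 2) ≤
      ∑' k, g k * pop ρ k := by
  classical
  have hg0 : ∀ k, 0 ≤ g k * pop ρ k := fun k =>
    mul_nonneg ((l1_nonneg _).trans (h k)) (hρ.pop_nonneg k)
  set t := s.biUnion fun k => (X (numVec k)).support
  have e1 : ∀ k ∈ s, ∑ l ∈ (X (numVec k)).support,
      ‖X (numVec k) l‖ * ((pop ρ k + pop ρ l) / 2) =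
      ∑ l ∈ t, ‖X (numVec k) l‖ * ((pop ρ k + pop ρ l) / 2) := fun k hk => by
    refine Finset.sum_subset
      (Finset.subset_biUnion_of_mem (fun k => (X (numVec k)).support) hk) fun l _ hl => ?_
    rw [Finsupp.notMem_support_iff.1 hl, norm_zero, zero_mul]
  have e2 : ∑ k ∈ s, ∑ l ∈ t, ‖X (numVec k) l‖ * pop ρ k ≤ ∑' k, g k * pop ρ k := by
    refine le_trans (Finset.sum_le_sum fun k _ => ?_) (hg.sum_le_tsum s fun k _ => hg0 k)
    rw [← Finset.sum_mul]
    exact mul_le_mul_of_nonneg_right ((sum_norm_le_l1 _ _).trans (h k)) (hρ.pop_nonneg k)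
  -- For fixed `l` the sum over `k` runs along a row of `X`, that is, along a column of the adjoint
  -- `X'`; this is where `h'` is needed.
  have e3 : ∑ k ∈ s, ∑ l ∈ t, ‖X (numVec k) l‖ * pop ρ l ≤ ∑' k, g k * pop ρ k := by
    rw [Finset.sum_comm]
    refine le_trans (Finset.sum_le_sum fun l _ => ?_) (hg.sum_le_tsum t fun k _ => hg0 k)
    rw [← Finset.sum_mul]
    refine mul_le_mul_of_nonneg_right (le_trans ?_ (h' l)) (hρ.pop_nonneg l)
    refine le_trans (le_of_eq ?_) (sum_norm_le_l1 _ s)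
    refine Finset.sum_congr rfl fun k _ => ?_
    rw [hX.apply_eq, RCLike.norm_conj]
  rw [Finset.sum_congr rfl e1]
  have e4 : ∑ k ∈ s, ∑ l ∈ t, ‖X (numVec k) l‖ * ((pop ρ k + pop ρ l) / 2) =
      (∑ k ∈ s, ∑ l ∈ t, ‖X (numVec k) l‖ * pop ρ k +
        ∑ k ∈ s, ∑ l ∈ t, ‖X (numVec k) l‖ * pop ρ l) / 2 := by
    simp only [← Finset.sum_add_distrib, Finset.sum_div]
    refine Finset.sum_congr rfl fun k _ => Finset.sum_congr rfl fun l _ => ?_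
    ring
  rw [e4]
  linarith

theorem norm_tr_le {X X' : Module.End ℂ (FinVec n)} (hX : IsAdj X X') (hf : IsFin X)
    {g : Occ n → ℝ} (h : ∀ k, l1 (X (numVec k)) ≤ g k) (h' : ∀ k, l1 (X' (numVec k)) ≤ g k)
    (hg : Summable fun k => g k * pop ρ k) : ‖tr ρ X‖ ≤ ∑' k, g k * pop ρ k := by
  obtain ⟨s, hs⟩ := hf.exists_finset
  rw [tr_eq_sum hs]
  refine le_trans (norm_sum_le_of_le _ fun k _ => ?_) (hρ.sum_sum_norm_le hX h h' hg s)
  have : ⟪incl n (numVec k), ρ (incl n (X (numVec k)))⟫_ℂ = form ρ (numVec k) (X (numVec k)) := rfl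
  rw [this, eq_sum_smul_numVec (X (numVec k)), map_sum, ← eq_sum_smul_numVec]
  refine norm_sum_le_of_le _ fun l _ => ?_
  rw [map_smul, norm_smul]
  exact mul_le_mul_of_nonneg_left (hρ.norm_entry_le k l) (norm_nonneg _)

theorem summable_inner_adj {X X' : Module.End ℂ (FinVec n)} (hX : IsAdj X X')
    {g : Occ n → ℝ} (h : ∀ k, l1 (X (numVec k)) ≤ g k) (h' : ∀ k, l1 (X' (numVec k)) ≤ g k)
    (hg : Summable fun k => g k * pop ρ k) :
    Summable fun k => ⟪incl n (X (numVec k)), ρ (incl n (numVec k))⟫_ℂ := by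
  refine Summable.of_norm (summable_of_sum_le (c := ∑' k, g k * pop ρ k)
    (fun k => norm_nonneg (_ : ℂ)) fun s => ?_)
  refine le_trans (Finset.sum_le_sum fun k _ => ?_) (hρ.sum_sum_norm_le hX h h' hg s)
  rw [inner_incl_eq_sum (Finset.Subset.refl _)]
  refine norm_sum_le_of_le _ fun l _ => ?_
  rw [norm_mul, RCLike.norm_conj, add_comm]
  exact mul_le_mul_of_nonneg_left (hρ.norm_entry_le l k) (norm_nonneg _)

theorem tr_diag (f : ℤ → ℝ) :
    tr ρ (diag f) = ((∑' k, f (level k) * pop ρ k : ℝ) : ℂ) := by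
  rw [tr, Complex.ofReal_tsum]
  refine tsum_congr fun k => ?_
  rw [diag_numVec, map_smul, map_smul, inner_smul_right, ← hρ.ofReal_pop, Complex.ofReal_mul]

end IsDensityMatrix

/-! ### Slowly varying weights -/

/-- The weight `|x| + 1`. -/
def br (x : ℤ) : ℝ := |(x : ℝ)| + 1

theorem one_le_br (x : ℤ) : 1 ≤ br x := by
  rw [br]
  linarith [abs_nonneg (x : ℝ)]

theorem br_of_nonneg {x : ℤ} (hx : 0 ≤ x) : br x = (x : ℝ) + 1 := by
  rw [br, abs_of_nonneg (by exact_mod_cast hx)]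

/-- The quadratic polynomial `x ^ 2 + R`. -/
def quad (R : ℝ) (x : ℤ) : ℝ := (x : ℝ) ^ 2 + R

theorem quad_pos {R : ℝ} (hR : 1 ≤ R) (x : ℤ) : 0 < quad R x := by rw [quad]; positivity

theorem quad_one_le {R : ℝ} (hR : 1 ≤ R) (x : ℤ) : quad 1 x ≤ quad R x := by
  rw [quad, quad]
  linarith

theorem one_le_quad_one (x : ℤ) : 1 ≤ quad 1 x := by rw [quad]; nlinarith [sq_nonneg (x : ℝ)]

theorem br_sq_le (x : ℤ) : br x ^ 2 ≤ 2 * quad 1 x := by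
  rw [br, quad]
  nlinarith [sq_abs (x : ℝ), sq_nonneg (|(x : ℝ)| - 1)]

theorem quad_one_le_br_sq (x : ℤ) : quad 1 x ≤ br x ^ 2 := by
  rw [br, quad]
  nlinarith [sq_abs (x : ℝ), abs_nonneg (x : ℝ)]

theorem quad_le_mul_quad_add {R B : ℝ} (hR : 1 ≤ R) (x a : ℤ) (ha : |(a : ℝ)| ≤ B) :
    quad R x ≤ (2 * B ^ 2 + 2) * quad R (x + a) := by
  have h1 : (a : ℝ) ^ 2 ≤ B ^ 2 := sq_le_sq' (by linarith [(abs_le.1 ha).1]) (abs_le.1 ha).2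
  rw [quad, quad]
  push_cast
  nlinarith [sq_nonneg ((x : ℝ) + 2 * a), sq_nonneg ((x : ℝ) + a),
    mul_nonneg (sq_nonneg B) (sq_nonneg ((x : ℝ) + a)), mul_nonneg (sq_nonneg B) (sub_nonneg.2 hR)]

/-- The first and second differences of `φ` are bounded like those of a logarithm, with
constant `h`. -/
structure LogSym (h φ : ℤ → ℝ) : Prop where
  first : ∀ x a : ℤ, |a| ≤ 2 → br x * |diff a φ x| ≤ h x
  second : ∀ x a b : ℤ, |a| ≤ 2 → |b| ≤ 2 → br x ^ 2 * |diff a (diff b φ) x| ≤ h x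

namespace LogSym

variable {h h' φ ψ : ℤ → ℝ}

theorem nonneg (hφ : LogSym h φ) (x : ℤ) : 0 ≤ h x :=
  (mul_nonneg (zero_le_one.trans (one_le_br x)) (abs_nonneg _)).trans (hφ.first x 0 (by norm_num))

theorem mono (hφ : LogSym h φ) (hh : ∀ x, h x ≤ h' x) : LogSym h' φ :=
  ⟨fun x a ha => (hφ.first x a ha).trans (hh x),
    fun x a b ha hb => (hφ.second x a b ha hb).trans (hh x)⟩

theorem add (hφ : LogSym h φ) (hψ : LogSym h' ψ) :
    LogSym (fun x => h x + h' x) (fun x => φ x + ψ x) := by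
  refine ⟨fun x a ha => ?_, fun x a b ha hb => ?_⟩
  · have e : diff a (fun x => φ x + ψ x) x = diff a φ x + diff a ψ x := by
      simp only [diff]; ring
    rw [e]
    refine le_trans ?_ (add_le_add (hφ.first x a ha) (hψ.first x a ha))
    rw [← mul_add]
    exact mul_le_mul_of_nonneg_left (abs_add_le _ _) (zero_le_one.trans (one_le_br x))
  · have e : diff a (diff b (fun x => φ x + ψ x)) x =
        diff a (diff b φ) x + diff a (diff b ψ) x := by
      simp only [diff]; ring
    rw [e]
    refine le_trans ?_ (add_le_add (hφ.second x a b ha hb) (hψ.second x a b ha hb))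
    rw [← mul_add]
    exact mul_le_mul_of_nonneg_left (abs_add_le _ _) (sq_nonneg _)

theorem mul_left (hφ : LogSym h φ) (c : ℝ) : LogSym (fun x => |c| * h x) (fun x => c * φ x) := by
  refine ⟨fun x a ha => ?_, fun x a b ha hb => ?_⟩
  · have e : diff a (fun x => c * φ x) x = c * diff a φ x := by simp only [diff]; ring
    rw [e, abs_mul, mul_left_comm]
    exact mul_le_mul_of_nonneg_left (hφ.first x a ha) (abs_nonneg c)
  · have e : diff a (diff b (fun x => c * φ x)) x = c * diff a (diff b φ) x := by
      simp only [diff]; ring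
    rw [e, abs_mul, mul_left_comm]
    exact mul_le_mul_of_nonneg_left (hφ.second x a b ha hb) (abs_nonneg c)

theorem const_sub (hφ : LogSym h φ) (c : ℝ) : LogSym h (fun x => c - φ x) := by
  refine ⟨fun x a ha => ?_, fun x a b ha hb => ?_⟩
  · have e : diff a (fun x => c - φ x) x = - diff a φ x := by simp only [diff]; ring
    rw [e, abs_neg]
    exact hφ.first x a ha
  · have e : diff a (diff b (fun x => c - φ x)) x = - diff a (diff b φ) x := by
      simp only [diff]; ring
    rw [e, abs_neg]
    exact hφ.second x a b ha hb

end LogSym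

/-! ### Exponentials of log-like functions -/

theorem abs_exp_sub_one_le {y c : ℝ} (hy : |y| ≤ c) :
    |Real.exp y - 1| ≤ |y| * Real.exp c := by
  have hc : 1 ≤ Real.exp c := Real.one_le_exp ((abs_nonneg y).trans hy)
  have h1 := Real.add_one_le_exp y
  have h2 := Real.add_one_le_exp (-y)
  have h3 : Real.exp y * Real.exp (-y) = 1 := by rw [← Real.exp_add]; simp
  have h4 : Real.exp y ≤ Real.exp c := Real.exp_le_exp.2 ((le_abs_self y).trans hy)
  rw [abs_le]
  constructor
  · have : |y| ≤ |y| * Real.exp c := le_mul_of_one_le_right (abs_nonneg y) hc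
    linarith [neg_abs_le y]
  · have h5 : Real.exp y - 1 ≤ y * Real.exp y := by nlinarith [Real.exp_pos y]
    have h6 : y * Real.exp y ≤ |y| * Real.exp y :=
      mul_le_mul_of_nonneg_right (le_abs_self y) (Real.exp_pos y).le
    have h7 : |y| * Real.exp y ≤ |y| * Real.exp c := mul_le_mul_of_nonneg_left h4 (abs_nonneg y)
    linarith

section exp

variable {h φ : ℤ → ℝ} {c : ℝ}

theorem LogSym.abs_diff_le (hφ : LogSym h φ) (hc : ∀ x, h x ≤ c) (x a : ℤ) (ha : |a| ≤ 2) :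
    |diff a φ x| ≤ c := by
  refine le_trans ?_ ((hφ.first x a ha).trans (hc x))
  exact le_mul_of_one_le_left (abs_nonneg _) (one_le_br x)

/-- The factor `Real.exp (φ x)` on the right is what makes Grönwall's inequality applicable: the
differences of the weight are bounded by the weight itself. -/
theorem LogSym.first_exp (hφ : LogSym h φ) (hc : ∀ x, h x ≤ c) (x a : ℤ) (ha : |a| ≤ 2) :
    br x * |diff a (fun x => Real.exp (φ x)) x| ≤ Real.exp c * h x * Real.exp (φ x) := by
  have e : diff a (fun x => Real.exp (φ x)) x =
      -(Real.exp (φ x) * (Real.exp (-diff a φ x) - 1)) := by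
    rw [mul_sub, ← Real.exp_add]
    simp only [diff]
    ring_nf
  have h1 := hφ.abs_diff_le hc x a ha
  have h2 := abs_exp_sub_one_le (y := -diff a φ x) (c := c) (by rwa [abs_neg])
  rw [abs_neg] at h2
  rw [e, abs_neg, abs_mul, abs_of_pos (Real.exp_pos _)]
  have hb : 0 ≤ br x := zero_le_one.trans (one_le_br x)
  calc br x * (Real.exp (φ x) * |Real.exp (-diff a φ x) - 1|)
      ≤ br x * (Real.exp (φ x) * (|diff a φ x| * Real.exp c)) := by gcongr
    _ = Real.exp c * (br x * |diff a φ x|) * Real.exp (φ x) := by ring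
    _ ≤ _ := by gcongr; exact hφ.first x a ha

theorem LogSym.second_exp (hφ : LogSym h φ) (hc : ∀ x, h x ≤ c) (x a b : ℤ) (ha : |a| ≤ 2)
    (hb : |b| ≤ 2) :
    br x ^ 2 * |diff a (diff b (fun x => Real.exp (φ x))) x| ≤
      ((c + 1) * Real.exp (3 * c)) * h x * Real.exp (φ x) := by
  set α := -diff a φ x with hα
  set β := -diff b φ x with hβ
  set δ := diff a (diff b φ) x with hδ
  -- The increment of φ along a + b is α + β + δ, so the bracket is e^{α+β+δ} - e^α - e^β + 1. Its
  -- two parts are controlled by a product of two first differences and by one second difference.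
  have e : diff a (diff b (fun x => Real.exp (φ x))) x = Real.exp (φ x) *
      ((Real.exp α - 1) * (Real.exp β - 1) + Real.exp (α + β) * (Real.exp δ - 1)) := by
    have e1 : Real.exp (φ (x + a)) = Real.exp (φ x) * Real.exp α := by
      rw [← Real.exp_add, hα, diff]; ring_nf
    have e2 : Real.exp (φ (x + b)) = Real.exp (φ x) * Real.exp β := by
      rw [← Real.exp_add, hβ, diff]; ring_nf
    have e3 : Real.exp (φ (x + a + b)) =
        Real.exp (φ x) * (Real.exp α * Real.exp β * Real.exp δ) := by
      rw [← Real.exp_add, ← Real.exp_add, ← Real.exp_add, hα, hβ, hδ]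
      simp only [diff]
      ring_nf
    simp only [diff, e1, e2, e3, Real.exp_add]
    ring
  have hbr := one_le_br x
  have hc0 : 0 ≤ c := (hφ.nonneg x).trans (hc x)
  have h1 : |α| ≤ c := by rw [hα, abs_neg]; exact hφ.abs_diff_le hc x a ha
  have h2 : |β| ≤ c := by rw [hβ, abs_neg]; exact hφ.abs_diff_le hc x b hb
  have h3 : br x ^ 2 * |δ| ≤ h x := hφ.second x a b ha hb
  have h4 : |δ| ≤ c := by
    refine le_trans (le_mul_of_one_le_left (abs_nonneg _) ?_) (h3.trans (hc x))
    nlinarith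
  have h5 : br x * |α| ≤ h x := by rw [hα, abs_neg]; exact hφ.first x a ha
  have h6 : br x * |β| ≤ h x := by rw [hβ, abs_neg]; exact hφ.first x b hb
  have g1 := abs_exp_sub_one_le h1
  have g2 := abs_exp_sub_one_le h2
  have g3 := abs_exp_sub_one_le h4
  have g4 : Real.exp (α + β) ≤ Real.exp (2 * c) :=
    Real.exp_le_exp.2 (by linarith [le_abs_self α, le_abs_self β])
  have hh := hφ.nonneg x
  rw [e, abs_mul, abs_of_pos (Real.exp_pos _)]
  have k1 : |(Real.exp α - 1) * (Real.exp β - 1) + Real.exp (α + β) * (Real.exp δ - 1)| ≤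
      (|α| * Real.exp c) * (|β| * Real.exp c) + Real.exp (2 * c) * (|δ| * Real.exp c) := by
    refine (abs_add_le _ _).trans (add_le_add ?_ ?_)
    · rw [abs_mul]; gcongr
    · rw [abs_mul, abs_of_pos (Real.exp_pos _)]; gcongr
  have k2 : Real.exp (3 * c) = Real.exp c * Real.exp c * Real.exp c := by
    rw [← Real.exp_add, ← Real.exp_add]; ring_nf
  have k3 : Real.exp (2 * c) = Real.exp c * Real.exp c := by
    rw [← Real.exp_add]; ring_nf
  have k4 : 1 ≤ Real.exp c := Real.one_le_exp hc0
  calc br x ^ 2 * (Real.exp (φ x) *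
        |(Real.exp α - 1) * (Real.exp β - 1) + Real.exp (α + β) * (Real.exp δ - 1)|)
      ≤ br x ^ 2 * (Real.exp (φ x) * ((|α| * Real.exp c) * (|β| * Real.exp c) +
          Real.exp (2 * c) * (|δ| * Real.exp c))) := by gcongr
    _ = ((br x * |α|) * (br x * |β|) * (Real.exp c * Real.exp c) +
          (br x ^ 2 * |δ|) * Real.exp (3 * c)) * Real.exp (φ x) := by rw [k2, k3]; ring
    _ ≤ (c * h x * (Real.exp c * Real.exp c * Real.exp c) + h x * Real.exp (3 * c)) *
          Real.exp (φ x) := by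
        have : (br x * |α|) * (br x * |β|) ≤ c * h x :=
          mul_le_mul (h5.trans (hc x)) h6 (by positivity) hc0
        have h8 : Real.exp c * Real.exp c ≤ Real.exp c * Real.exp c * Real.exp c :=
          le_mul_of_one_le_right (by positivity) k4
        gcongr
    _ = _ := by rw [← k2]; ring

end exp

/-! ### Logarithms of quadratic polynomials -/

/-- Both signs follow from log z ≤ z - 1; the comparison of `u` with `v` then puts the denominator
at the base point `u`. -/
theorem abs_log_sub_log_le {u v κ : ℝ} (hu : 0 < u) (hv : 0 < v) (hκ : 1 ≤ κ) (h : u ≤ κ * v) :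
    |Real.log u - Real.log v| ≤ κ * |u - v| / u := by
  have h1 : Real.log v - Real.log u ≤ |u - v| / u := by
    rw [← Real.log_div hv.ne' hu.ne']
    refine (Real.log_le_sub_one_of_pos (by positivity)).trans ?_
    rw [le_div_iff₀ hu, sub_mul, div_mul_cancel₀ _ hu.ne', one_mul, abs_sub_comm]
    exact le_abs_self _
  have h2 : Real.log u - Real.log v ≤ |u - v| / v := by
    rw [← Real.log_div hu.ne' hv.ne']
    refine (Real.log_le_sub_one_of_pos (by positivity)).trans ?_
    rw [le_div_iff₀ hv, sub_mul, div_mul_cancel₀ _ hv.ne', one_mul]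
    exact le_abs_self _
  have h3 : |u - v| / u ≤ κ * |u - v| / u := by
    gcongr
    exact le_mul_of_one_le_left (abs_nonneg _) hκ
  have h4 : |u - v| / v ≤ κ * |u - v| / u := by
    rw [div_le_div_iff₀ hv hu]
    nlinarith [abs_nonneg (u - v)]
  rw [abs_le]
  constructor <;> linarith

theorem abs_cast_le {a : ℤ} (ha : |a| ≤ 2) : |(a : ℝ)| ≤ 2 := by exact_mod_cast ha

/-- The logarithms of the polynomials `x ^ 2 + R` satisfy the difference bounds uniformly
in `R`. -/
theorem logSym_log_quad : ∃ c : ℝ, 0 ≤ c ∧ ∀ R : ℝ, 1 ≤ R →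
    LogSym (fun x => c * (quad 1 x / quad R x)) (fun x => Real.log (quad R x)) := by
  -- The constant is the one for second differences, 100·40·34·2. The numbers 10 and 34 are the
  -- values of 2B² + 2 for shifts B = 2 and B = 4, 40 comes from `h6`, and 2 from `br_sq_le`. First
  -- differences need only 80.
  refine ⟨10 * (10 * 34) * 80, by norm_num, fun R hR => ⟨fun x a ha => ?_, fun x a b ha hb => ?_⟩⟩
  · have hu := quad_pos hR x
    have hv := quad_pos hR (x + a)
    have ha' := abs_cast_le ha
    have h1 := quad_le_mul_quad_add hR x a ha'
    norm_num at h1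
    have h2 := abs_log_sub_log_le hu hv (by norm_num) h1
    have h3 : |quad R x - quad R (x + a)| ≤ 4 * br x := by
      have : quad R x - quad R (x + a) = -(a * (2 * x + a)) := by
        simp only [quad]; push_cast; ring
      rw [this, abs_neg, abs_mul, br]
      have : |(2 * x + a : ℝ)| ≤ 2 * |(x : ℝ)| + 2 := by
        refine (abs_add_le _ _).trans ?_
        rw [abs_mul, abs_two]
        linarith
      nlinarith [abs_nonneg (a : ℝ), abs_nonneg (2 * x + a : ℝ), abs_nonneg (x : ℝ)]
    have hbr := one_le_br x
    calc br x * |diff a (fun x => Real.log (quad R x)) x|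
        ≤ br x * (10 * |quad R x - quad R (x + a)| / quad R x) := by gcongr; exact h2
      _ ≤ br x * (10 * (4 * br x) / quad R x) := by gcongr
      _ = 40 * (br x ^ 2 / quad R x) := by ring
      _ ≤ 40 * (2 * quad 1 x / quad R x) := by gcongr; exact br_sq_le x
      _ = 80 * (quad 1 x / quad R x) := by ring
      _ ≤ _ := by
        have : 0 ≤ quad 1 x / quad R x := (div_pos (quad_pos le_rfl x) hu).le
        gcongr
        norm_num
  · have hu := quad_pos hR x
    have hua := quad_pos hR (x + a)
    have hub := quad_pos hR (x + b)
    have huab := quad_pos hR (x + a + b)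
    have ha' := abs_cast_le ha
    have hb' := abs_cast_le hb
    have h1 := quad_le_mul_quad_add hR x a ha'
    have h2 := quad_le_mul_quad_add hR (x + a + b) (-a) (B := 2) (by push_cast; rwa [abs_neg])
    rw [show x + a + b + -a = x + b by ring] at h2
    have h3 := quad_le_mul_quad_add hR x (a + b) (B := 4) (by
      push_cast
      exact (abs_add_le _ _).trans (by linarith))
    rw [← add_assoc] at h3
    norm_num at h1 h2 h3
    have h4 : quad R x * quad R (x + a + b) ≤ 100 * (quad R (x + a) * quad R (x + b)) := by
      calc _ ≤ (10 * quad R (x + a)) * (10 * quad R (x + b)) := by gcongr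
        _ = _ := by ring
    have h5 := abs_log_sub_log_le (by positivity) (by positivity) (by norm_num) h4
    -- A second difference of a logarithm is the logarithm of a cross ratio, so `abs_log_sub_log_le`
    -- applies to products of two values.
    have e : diff a (diff b (fun x => Real.log (quad R x))) x =
        Real.log (quad R x * quad R (x + a + b)) - Real.log (quad R (x + a) * quad R (x + b)) := by
      rw [Real.log_mul hu.ne' huab.ne', Real.log_mul hua.ne' hub.ne']
      simp only [diff]
      ring
    have hbr := one_le_br x
    have h6 : |quad R x * quad R (x + a + b) - quad R (x + a) * quad R (x + b)| ≤
        40 * quad R x := by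
      -- The terms of degree four in x cancel; what remains is of the size of `quad R x`.
      have e2 : quad R x * quad R (x + a + b) - quad R (x + a) * quad R (x + b) =
          2 * (a * b) * quad R x - (a * (2 * x + a)) * (b * (2 * x + b)) := by
        simp only [quad]; push_cast; ring
      have hx : ∀ a : ℤ, |(a : ℝ)| ≤ 2 → |(a * (2 * x + a) : ℝ)| ≤ 4 * br x := fun a ha' => by
        rw [abs_mul, br]
        have : |(2 * x + a : ℝ)| ≤ 2 * |(x : ℝ)| + 2 := by
          refine (abs_add_le _ _).trans ?_
          rw [abs_mul, abs_two]
          linarith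
        nlinarith [abs_nonneg (a : ℝ), abs_nonneg (2 * x + a : ℝ), abs_nonneg (x : ℝ)]
      have hab : |(2 * (a * b) : ℝ)| ≤ 8 := by
        rw [abs_mul, abs_mul, abs_two]
        nlinarith [abs_nonneg (a : ℝ), abs_nonneg (b : ℝ)]
      have hbq := br_sq_le x
      have hq := quad_one_le hR x
      rw [e2]
      calc _ ≤ |(2 * (a * b) : ℝ)| * quad R x + (4 * br x) * (4 * br x) := by
            refine (abs_sub _ _).trans (add_le_add ?_ ?_)
            · rw [abs_mul _ (quad R x), abs_of_pos hu]
            · rw [abs_mul (a * (2 * x + a) : ℝ)]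
              exact mul_le_mul (hx a ha') (hx b hb') (abs_nonneg _) (by linarith)
        _ ≤ 8 * quad R x + 16 * (2 * quad R x) := by nlinarith
        _ = _ := by ring
    rw [e]
    calc br x ^ 2 * |_| ≤ br x ^ 2 *
          (100 * (40 * quad R x) / (quad R x * quad R (x + a + b))) := by
          gcongr
          refine h5.trans ?_
          gcongr
      _ = br x ^ 2 * 4000 / quad R (x + a + b) := by field_simp; norm_num
      _ ≤ br x ^ 2 * 4000 / (quad R x / 34) := by
          gcongr
          linarith
      _ = 4000 * 34 * (br x ^ 2 / quad R x) := by field_simp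
      _ ≤ 4000 * 34 * (2 * quad 1 x / quad R x) := by gcongr; exact br_sq_le x
      _ = _ := by ring

/-! ### Sharp truncation -/

/-- Restriction to `x ≤ L`. -/
def cut (L : ℤ) (g : ℤ → ℝ) (x : ℤ) : ℝ := if x ≤ L then g x else 0

theorem cut_of_le {L x : ℤ} (h : x ≤ L) (g : ℤ → ℝ) : cut L g x = g x := if_pos h

theorem cut_of_lt {L x : ℤ} (h : L < x) (g : ℤ → ℝ) : cut L g x = 0 := if_neg (not_le.2 h)

theorem cut_nonneg {g : ℤ → ℝ} (hg : ∀ x, 0 ≤ g x) (L x : ℤ) : 0 ≤ cut L g x := by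
  rw [cut]
  split_ifs
  exacts [hg x, le_rfl]

theorem cut_le {g : ℤ → ℝ} (hg : ∀ x, 0 ≤ g x) (L x : ℤ) : cut L g x ≤ g x := by
  rw [cut]
  split_ifs
  exacts [le_rfl, hg x]

/-- Up to L - 4 no shift crosses the cut, and the differences are those of `g`. Beyond, each of the
at most four values in a difference is small by the decay of `g`. -/
theorem eventually_cut {g : ℤ → ℝ} (hg : ∀ x, 0 ≤ g x)
    (hlim : Tendsto (fun x => br x ^ 2 * g x) atTop (𝓝 0)) {ε : ℝ} (hε : 0 < ε) :
    ∀ᶠ L in atTop, ∀ x : ℤ, 0 ≤ x →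
      (∀ a : ℤ, |a| ≤ 2 →
        br x * |diff a (cut L g) x| ≤ cut L (fun x => br x * |diff a g x|) x + ε) ∧
      (∀ a b : ℤ, |a| ≤ 2 → |b| ≤ 2 → br x ^ 2 * |diff a (diff b (cut L g)) x| ≤
        cut L (fun x => br x ^ 2 * |diff a (diff b g) x|) x + ε) := by
  -- 100 = 4·25: a second difference has four values, and `br x` is at most `5 * br (x + a)` for
  -- shifts up to 4. The 8 below leaves room for x > L - 4 and a shift by -4.
  obtain ⟨M, hM⟩ := eventually_atTop.1 (hlim.eventually_lt_const (show 0 < ε / 100 by positivity))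
  filter_upwards [eventually_ge_atTop (M + 8)] with L hL x hx
  rcases le_or_gt x (L - 4) with hxL | hxL
  · refine ⟨fun a ha => ?_, fun a b ha hb => ?_⟩
    · have h1 := (abs_le.1 ha).2
      rw [cut_of_le (by omega)]
      simp only [diff, cut_of_le (show x ≤ L by omega), cut_of_le (show x + a ≤ L by omega)]
      linarith
    · have h1 := (abs_le.1 ha).2
      have h2 := (abs_le.1 hb).2
      rw [cut_of_le (by omega)]
      simp only [diff, cut_of_le (show x ≤ L by omega), cut_of_le (show x + a ≤ L by omega),
        cut_of_le (show x + b ≤ L by omega), cut_of_le (show x + a + b ≤ L by omega)]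
      linarith
  · have hbr := one_le_br x
    have hval : ∀ a : ℤ, |a| ≤ 4 → br x ^ 2 * |cut L g (x + a)| ≤ ε / 4 := fun a ha => by
      have h1 := (abs_le.1 ha).1
      have h2 := hM (x + a) (by omega)
      have h3 : br x ≤ 5 * br (x + a) := by
        have h4 := abs_sub_abs_le_abs_sub (x : ℝ) (x + a : ℝ)
        have h5 : |(a : ℝ)| ≤ 4 := by exact_mod_cast ha
        have h6 := abs_nonneg ((x : ℝ) + a)
        rw [sub_add_cancel_left, abs_neg] at h4
        rw [br, br]
        push_cast
        linarith
      rw [abs_of_nonneg (cut_nonneg hg _ _)]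
      have h7 := cut_le hg L (x + a)
      have h8 := hg (x + a)
      have h9 := cut_nonneg hg L (x + a)
      calc br x ^ 2 * cut L g (x + a) ≤ (5 * br (x + a)) ^ 2 * g (x + a) := by gcongr
        _ = 25 * (br (x + a) ^ 2 * g (x + a)) := by ring
        _ ≤ _ := by linarith
    have hx0 : br x ^ 2 * |cut L g x| ≤ ε / 4 := by simpa using hval 0 (by norm_num)
    refine ⟨fun a ha => ?_, fun a b ha hb => ?_⟩
    · have h0 : 0 ≤ cut L (fun x => br x * |diff a g x|) x :=
        cut_nonneg (fun x => mul_nonneg (zero_le_one.trans (one_le_br x)) (abs_nonneg _)) _ _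
      have h1 := hval a (by omega)
      have h2 : br x * |diff a (cut L g) x| ≤ br x ^ 2 * (|cut L g x| + |cut L g (x + a)|) := by
        refine mul_le_mul (by nlinarith) (abs_sub _ _) (abs_nonneg _) (sq_nonneg _)
      linarith
    · have h0 : 0 ≤ cut L (fun x => br x ^ 2 * |diff a (diff b g) x|) x :=
        cut_nonneg (fun x => mul_nonneg (sq_nonneg _) (abs_nonneg _)) _ _
      have h1 := hval a (by omega)
      have h2 := hval b (by omega)
      have h3 := hval (a + b) ((abs_add_le _ _).trans (by omega))
      rw [← add_assoc] at h3
      have h4 : br x ^ 2 * |diff a (diff b (cut L g)) x| ≤ br x ^ 2 *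
          ((|cut L g x| + |cut L g (x + b)|) + (|cut L g (x + a)| + |cut L g (x + a + b)|)) := by
        refine mul_le_mul_of_nonneg_left ?_ (sq_nonneg _)
        exact (abs_sub _ _).trans (add_le_add (abs_sub _ _) (abs_sub _ _))
      linarith

/-! ### Propagation of weighted populations -/

theorem IsAdj.comm_comm {C X X' : Module.End ℂ (FinVec n)} (hC : IsAdj C C) (hX : IsAdj X X') :
    IsAdj (comm C (comm C X)) (comm C (comm C X')) := by
  have := hC.commutator (hC.commutator hX)
  have e : (X' * C - C * X') * C - C * (X' * C - C * X') = comm C (comm C X') := by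
    rw [comm, comm]; noncomm_ring
  rwa [e] at this

theorem le_of_forall_le_add_mul {x y z : ℝ} (hz : 0 ≤ z) (h : ∀ ε, 0 < ε → x ≤ y + z * ε) :
    x ≤ y := by
  refine le_of_forall_pos_le_add fun δ hδ => (h (δ / (z + 1)) (by positivity)).trans ?_
  have : z * (δ / (z + 1)) ≤ δ := by
    rw [mul_div_assoc', div_le_iff₀ (by positivity)]
    nlinarith
  linarith

theorem br_level (k : Occ n) : br (level k) = (level k : ℝ) + 1 := br_of_nonneg (level_nonneg k)

theorem wt_sq_eq_br (k : Occ n) : wt k ^ 2 = br (level k) := by rw [wt_sq, br_level]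

theorem tendsto_const_div_quad (c : ℝ) (x : ℤ) :
    Tendsto (fun R : ℝ => c / quad R x) atTop (𝓝 0) :=
  tendsto_const_nhds.div_atTop (tendsto_atTop_add_const_left _ _ tendsto_id)

theorem tendsto_div_quad (x : ℤ) : Tendsto (fun R : ℝ => R / quad R x) atTop (𝓝 1) := by
  have h := (tendsto_const_div_quad ((x : ℝ) ^ 2) x).const_sub 1
  rw [sub_zero] at h
  refine h.congr' ?_
  filter_upwards [eventually_ge_atTop 1] with R hR
  have := quad_pos hR x
  rw [eq_div_iff this.ne', sub_mul, div_mul_cancel₀ _ this.ne', quad]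
  ring

variable {N : ℕ}

/-- Bound on the dissipator applied to a function of the total number. -/
theorem exists_norm_sum_tr_le (K : Fin N → Matrix (Idx n) (Idx n) ℂ)
    (hC : ∀ j, IsAdj (quadOp (K j)) (quadOp (K j))) :
    ∃ D, 0 ≤ D ∧ ∀ (ρ : Fock n →L[ℂ] Fock n), IsDensityMatrix ρ → ∀ (f h : ℤ → ℝ),
      IsFin (diag f : Module.End ℂ (FinVec n)) →
      (∀ x a : ℤ, 0 ≤ x → |a| ≤ 2 → br x * |diff a f x| ≤ h x) →
      (∀ x a b : ℤ, 0 ≤ x → |a| ≤ 2 → |b| ≤ 2 → br x ^ 2 * |diff a (diff b f) x| ≤ h x) →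
      (Summable fun k : Occ n => h (level k) * pop ρ k) →
      ‖∑ j, tr ρ (comm (quadOp (K j)) (comm (quadOp (K j)) (diag f)))‖ ≤
        D * ∑' k : Occ n, h (level k) * pop ρ k := by
  choose c hc hcb using fun j =>
    HasOrder.one.exists_l1_mul_double_commutator_diag_le (K j)
  refine ⟨∑ j, c j, Finset.sum_nonneg fun j _ => hc j, fun ρ hρ f h hf h1 h2 hs => ?_⟩
  rw [Finset.sum_mul]
  refine norm_sum_le_of_le _ fun j _ => ?_
  have hb : ∀ k : Occ n, l1 (comm (quadOp (K j)) (comm (quadOp (K j)) (diag f)) (numVec k)) ≤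
      c j * h (level k) := fun k => by
    have := hcb j f k (h (level k)) (fun a ha => ?_) fun a b ha hb => ?_
    · rwa [one_mul, pow_zero, one_mul] at this
    · rw [← br_level]; exact h1 _ a (level_nonneg k) ha
    · rw [← br_level]; exact h2 _ a b (level_nonneg k) ha hb
  rw [← tsum_mul_left]
  simp only [← mul_assoc]
  refine hρ.norm_tr_le ((hC j).comm_comm (isAdj_diag f)) ((hf.comm (hC j)).comm (hC j)) hb hb ?_
  simpa only [mul_assoc] using hs.mul_left (c j)

theorem IsFin.summable_diag {f : ℤ → ℝ} (hf : IsFin (diag f : Module.End ℂ (FinVec n)))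
    (p : Occ n → ℝ) : Summable fun k : Occ n => f (level k) * p k := by
  obtain ⟨s, hs⟩ := hf.exists_finset
  refine summable_of_ne_finset_zero (s := s) fun k hk => ?_
  have := hs k hk
  rw [diag_numVec, smul_eq_zero] at this
  rcases this with h | h
  · rw [Complex.ofReal_eq_zero.1 h, zero_mul]
  · simp at h

theorem isFin_diag_cut (L : ℤ) (g : ℤ → ℝ) :
    IsFin (diag (cut L g) : Module.End ℂ (FinVec n)) :=
  isFin_diag (L := L) fun _ hx => cut_of_lt hx g

section solution

variable {K : Fin N → Matrix (Idx n) (Idx n) ℂ} {ρ : ℝ → (Fock n →L[ℂ] Fock n)}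

theorem IsSolution.continuousOn_tr (hρ : IsSolution (fun j => quadOp (K j)) ρ)
    (hC : ∀ j, IsAdj (quadOp (K j)) (quadOp (K j))) {X : Module.End ℂ (FinVec n)} (hX : IsFin X)
    (t : ℝ) : ContinuousOn (fun s => tr (ρ s) X) (Set.Icc 0 t) := fun _ hs =>
  ((hρ.hasDerivWithinAt_tr hC hX hs.1).mono Set.Icc_subset_Ici_self).continuousWithinAt

/-- Grönwall's inequality for a rapidly decaying weight, cut off at a level `L` that contains `F`.
The cut adds an error `ε` times the total population, which is one, and `ε` is arbitrary. The rate
is chosen before `φ`, hence depends on it only through `c`. -/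
theorem IsSolution.exists_sum_exp_le (hρ : IsSolution (fun j => quadOp (K j)) ρ)
    (hC : ∀ j, IsAdj (quadOp (K j)) (quadOp (K j))) {c : ℝ} (hc : 0 ≤ c) :
    ∃ Λ, 0 ≤ Λ ∧ ∀ φ : ℤ → ℝ, LogSym (fun _ => c) φ →
      Tendsto (fun x => br x ^ 2 * Real.exp (φ x)) atTop (𝓝 0) →
      (Summable fun k : Occ n => Real.exp (φ (level k)) * pop (ρ 0) k) →
      ∀ t, 0 ≤ t → ∀ F : Finset (Occ n), ∑ k ∈ F, Real.exp (φ (level k)) * pop (ρ t) k ≤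
        Real.exp (Λ * t) * ∑' k : Occ n, Real.exp (φ (level k)) * pop (ρ 0) k := by
  obtain ⟨D, hD, hDb⟩ := exists_norm_sum_tr_le K hC
  set A := (c + 1) * Real.exp (3 * c) * c with hA
  have hA0 : 0 ≤ A := by positivity
  -- The summand 1 keeps the rate away from zero in Grönwall's bound and makes the division by `Λ`
  -- harmless.
  set Λ := D * A + 1 with hΛ
  have hΛ1 : 1 ≤ Λ := by rw [hΛ]; nlinarith [mul_nonneg hD hA0]
  refine ⟨Λ, zero_le_one.trans hΛ1, fun φ hφ hlim hsum t ht F => ?_⟩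
  set g : ℤ → ℝ := fun x => Real.exp (φ x) with hg
  have hg0 : ∀ x, 0 ≤ g x := fun x => (Real.exp_pos _).le
  have hg1 : ∀ x a : ℤ, |a| ≤ 2 → br x * |diff a g x| ≤ A * g x := fun x a ha => by
    refine (hφ.first_exp (fun _ => le_rfl) x a ha).trans ?_
    have h1 : Real.exp c ≤ (c + 1) * Real.exp (3 * c) := by
      have : Real.exp c ≤ Real.exp (3 * c) := Real.exp_le_exp.2 (by linarith)
      nlinarith [Real.exp_pos (3 * c)]
    exact mul_le_mul_of_nonneg_right (mul_le_mul_of_nonneg_right h1 hc) (hg0 x)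
  have hg2 : ∀ x a b : ℤ, |a| ≤ 2 → |b| ≤ 2 → br x ^ 2 * |diff a (diff b g) x| ≤ A * g x :=
    fun x a b ha hb => hφ.second_exp (fun _ => le_rfl) x a b ha hb
  have hp := fun s (hs : 0 ≤ s) => (hρ.isDensityMatrix s hs).pop_nonneg
  refine le_of_forall_le_add_mul (z := Real.exp (Λ * t) * D)
    (mul_nonneg (Real.exp_pos _).le hD) fun ε hε => ?_
  obtain ⟨L, hL, hFL⟩ := ((eventually_cut hg0 hlim hε).and
    (F.eventually_all.2 fun k _ => eventually_ge_atTop (level k))).exists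
  set f := cut L g with hf
  have hfin : IsFin (diag f : Module.End ℂ (FinVec n)) := isFin_diag_cut L g
  have hf0 : ∀ x, 0 ≤ f x := cut_nonneg hg0 L
  have hcutle : ∀ (q : ℤ → ℝ) (x : ℤ), q x ≤ A * g x → cut L q x ≤ A * f x := fun q x hq => by
    rw [hf, cut, cut]
    split_ifs
    · exact hq
    · simp
  have hu : ∀ s, 0 ≤ s → ‖tr (ρ s) (diag f)‖ = ∑' k : Occ n, f (level k) * pop (ρ s) k :=
    fun s hs => by
      rw [(hρ.isDensityMatrix s hs).tr_diag, Complex.norm_real, Real.norm_of_nonneg]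
      exact tsum_nonneg fun k => mul_nonneg (hf0 _) (hp s hs k)
  have hgr := norm_le_gronwallBound_of_norm_deriv_right_le (f := fun s => tr (ρ s) (diag f))
    (f' := fun s => -(1 / 2 : ℂ) *
      ∑ j, tr (ρ s) (comm (quadOp (K j)) (comm (quadOp (K j)) (diag f))))
    (δ := ‖tr (ρ 0) (diag f)‖) (K := Λ) (ε := D * ε) (a := 0) (b := t)
    (hρ.continuousOn_tr hC hfin t)
    (fun s hs => (hρ.hasDerivWithinAt_tr hC hfin hs.1).mono (Set.Ici_subset_Ici.2 hs.1))
    le_rfl (fun s hs => by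
      have hds := hρ.isDensityMatrix s hs.1
      have hsumf := hfin.summable_diag (pop (ρ s))
      have e1 : ∀ k : Occ n, (A * f (level k) + ε) * pop (ρ s) k =
          A * (f (level k) * pop (ρ s) k) + ε * pop (ρ s) k := fun k => by ring
      have hs1 := (hsumf.mul_left A).add (hds.hasSum_pop.summable.mul_left ε)
      have h1 := hDb (ρ s) hds f (fun x => A * f x + ε) hfin
        (fun x a hx ha => ((hL x hx).1 a ha).trans
          (add_le_add_left (hcutle _ x (hg1 x a ha)) ε))
        (fun x a b hx ha hb => ((hL x hx).2 a b ha hb).trans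
          (add_le_add_left (hcutle _ x (hg2 x a b ha hb)) ε))
        (by simpa only [e1] using hs1)
      simp only [e1] at h1
      rw [(hsumf.mul_left A).tsum_add (hds.hasSum_pop.summable.mul_left ε), tsum_mul_left,
        tsum_mul_left, hds.hasSum_pop.tsum_eq, ← hu s hs.1] at h1
      rw [norm_mul]
      have h2 : ‖-(1 / 2 : ℂ)‖ ≤ 1 := by norm_num
      refine (mul_le_mul h2 h1 (norm_nonneg _) zero_le_one).trans ?_
      rw [hΛ]
      nlinarith [norm_nonneg (tr (ρ s) (diag f : Module.End ℂ (FinVec n)))])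
    t ⟨ht, le_rfl⟩
  rw [gronwallBound_of_K_ne_0 (by linarith), sub_zero, hu t ht, hu 0 le_rfl] at hgr
  have h3 : ∑ k ∈ F, g (level k) * pop (ρ t) k ≤ ∑' k : Occ n, f (level k) * pop (ρ t) k := by
    refine le_trans (le_of_eq ?_) ((hfin.summable_diag (pop (ρ t))).sum_le_tsum F
      fun k _ => mul_nonneg (hf0 _) (hp t ht k))
    exact Finset.sum_congr rfl fun k hk => by rw [hf, cut_of_le (hFL k hk)]
  have h4 : ∑' k : Occ n, f (level k) * pop (ρ 0) k ≤ ∑' k : Occ n, g (level k) * pop (ρ 0) k :=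
    (hfin.summable_diag (pop (ρ 0))).tsum_le_tsum
      (fun k => mul_le_mul_of_nonneg_right (cut_le hg0 L _) (hp 0 le_rfl k)) hsum
  have h5 : 1 ≤ Real.exp (Λ * t) := Real.one_le_exp (by positivity)
  have h6 : D * ε / Λ * (Real.exp (Λ * t) - 1) ≤ Real.exp (Λ * t) * D * ε := by
    have : D * ε / Λ ≤ D * ε := div_le_self (by positivity) hΛ1
    have h7 : 0 ≤ D * ε := by positivity
    nlinarith
  calc _ ≤ _ := h3
    _ ≤ _ := hgr
    _ ≤ _ := by
      refine add_le_add ?_ h6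
      rw [mul_comm]
      exact mul_le_mul_of_nonneg_left h4 (by positivity)

/-- Weighted populations grow at most exponentially, at a rate that depends only on the
constants in the bounds on the weight. -/
theorem IsSolution.exists_summable_exp (hρ : IsSolution (fun j => quadOp (K j)) ρ)
    (hC : ∀ j, IsAdj (quadOp (K j)) (quadOp (K j))) {c : ℝ} (hc : 0 ≤ c) (s : ℕ) :
    ∃ Λ, 0 ≤ Λ ∧ ∀ φ : ℤ → ℝ, LogSym (fun _ => c) φ → ∀ A : ℝ,
      (∀ x, Real.exp (φ x) ≤ A * quad 1 x ^ s) →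
      (Summable fun k : Occ n => Real.exp (φ (level k)) * pop (ρ 0) k) →
      ∀ t, 0 ≤ t → (Summable fun k : Occ n => Real.exp (φ (level k)) * pop (ρ t) k) ∧
        ∑' k : Occ n, Real.exp (φ (level k)) * pop (ρ t) k ≤
        Real.exp (Λ * t) * ∑' k : Occ n, Real.exp (φ (level k)) * pop (ρ 0) k := by
  obtain ⟨c₀, hc₀, hlog⟩ := logSym_log_quad
  -- The damping factor (R/(x²+R))^q has `s` powers to absorb the growth of the weight, one to
  -- absorb `br x ^ 2`, and one to spare for decay.
  set q : ℝ := (s : ℝ) + 2 with hq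
  obtain ⟨Λ, hΛ, H⟩ := hρ.exists_sum_exp_le hC (c := c + q * c₀) (by positivity)
  refine ⟨Λ, hΛ, fun φ hφ A hA hsum t ht => ?_⟩
  have hp := fun s (hs : 0 ≤ s) => (hρ.isDensityMatrix s hs).pop_nonneg
  have key : ∀ F : Finset (Occ n), ∑ k ∈ F, Real.exp (φ (level k)) * pop (ρ t) k ≤
      Real.exp (Λ * t) * ∑' k : Occ n, Real.exp (φ (level k)) * pop (ρ 0) k := fun F => by
    have hexp : ∀ R : ℝ, 1 ≤ R → ∀ x, Real.exp (φ x + q * (Real.log R - Real.log (quad R x))) =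
        Real.exp (φ x) * (R / quad R x) ^ (s + 2) := fun R hR x => by
      have hRx := quad_pos hR x
      rw [Real.exp_add, ← Real.log_div (by positivity) hRx.ne',
        show q = ((s + 2 : ℕ) : ℝ) by push_cast; rfl, Real.exp_nat_mul,
        Real.exp_log (by positivity)]
    have hle1 : ∀ R : ℝ, 1 ≤ R → ∀ x, R / quad R x ≤ 1 := fun R hR x => by
      rw [div_le_one (quad_pos hR x), quad]
      nlinarith [sq_nonneg (x : ℝ)]
    have hle : ∀ R : ℝ, 1 ≤ R → ∀ x,
        Real.exp (φ x + q * (Real.log R - Real.log (quad R x))) ≤ Real.exp (φ x) :=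
      fun R hR x => by
        rw [hexp R hR x]
        have hRx := quad_pos hR x
        exact mul_le_of_le_one_right (Real.exp_pos _).le
          (pow_le_one₀ (by positivity) (hle1 R hR x))
    have hR : ∀ᶠ R : ℝ in atTop, ∑ k ∈ F, (Real.exp (φ (level k)) *
        (R / quad R (level k)) ^ (s + 2)) * pop (ρ t) k ≤
        Real.exp (Λ * t) * ∑' k : Occ n, Real.exp (φ (level k)) * pop (ρ 0) k := by
      filter_upwards [eventually_ge_atTop 1] with R hR
      -- The constant does not depend on `R`, so neither does the rate, and the damping can be
      -- removed by letting `R` tend to infinity on the finite set `F`.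
      have hsym : LogSym (fun _ => c + q * c₀)
          (fun x => φ x + q * (Real.log R - Real.log (quad R x))) := by
        refine (hφ.add (((hlog R hR).const_sub (Real.log R)).mul_left q)).mono fun x => ?_
        have hq0 : 0 ≤ q := by positivity
        rw [abs_of_nonneg hq0]
        have : quad 1 x / quad R x ≤ 1 := (div_le_one (quad_pos hR x)).2 (quad_one_le hR x)
        have : c₀ * (quad 1 x / quad R x) ≤ c₀ := mul_le_of_le_one_right hc₀ this
        have := mul_le_mul_of_nonneg_left this hq0
        linarith
      have hsumR : Summable fun k : Occ n =>
          Real.exp (φ (level k) + q * (Real.log R - Real.log (quad R (level k)))) *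
            pop (ρ 0) k :=
        Summable.of_nonneg_of_le (fun k => mul_nonneg (Real.exp_pos _).le (hp 0 le_rfl k))
          (fun k => mul_le_mul_of_nonneg_right (hle R hR _) (hp 0 le_rfl k)) hsum
      have hlimR : Tendsto (fun x : ℤ => br x ^ 2 *
          Real.exp (φ x + q * (Real.log R - Real.log (quad R x)))) atTop (𝓝 0) := by
        have hA0 : 0 ≤ A := by
          have := (Real.exp_pos _).le.trans (hA 0)
          simpa [quad] using this
        have hbound : ∀ x : ℤ, br x ^ 2 *
            Real.exp (φ x + q * (Real.log R - Real.log (quad R x))) ≤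
            2 * A * R ^ (s + 2) * (quad 1 x)⁻¹ := fun x => by
          have h1 := quad_pos le_rfl x
          have h2 := quad_pos hR x
          have h3 : (R / quad R x) ^ (s + 2) ≤ (R / quad 1 x) ^ (s + 2) := by
            gcongr
            exact quad_one_le hR x
          rw [hexp R hR x]
          calc br x ^ 2 * (Real.exp (φ x) * (R / quad R x) ^ (s + 2))
              ≤ (2 * quad 1 x) * ((A * quad 1 x ^ s) * (R / quad 1 x) ^ (s + 2)) := by
                gcongr
                · exact br_sq_le x
                · exact hA x
            _ = _ := by
              rw [div_pow]
              field_simp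
              ring
        refine squeeze_zero (fun x => by positivity) hbound ?_
        rw [← mul_zero (2 * A * R ^ (s + 2))]
        refine Tendsto.const_mul _ (tendsto_inv_atTop_zero.comp ?_)
        refine tendsto_atTop_mono (f := fun x : ℤ => (x : ℝ)) (fun x => ?_)
          tendsto_intCast_atTop_atTop
        rw [quad]
        nlinarith [sq_nonneg ((x : ℝ) - 1)]
      have h1 := H _ hsym hlimR hsumR t ht F
      simp only [← hexp R hR]
      refine h1.trans (mul_le_mul_of_nonneg_left ?_ (Real.exp_pos _).le)
      exact hsumR.tsum_le_tsum (fun k => mul_le_mul_of_nonneg_right (hle R hR _)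
        (hp 0 le_rfl k)) hsum
    refine le_of_tendsto (tendsto_finsetSum F fun k _ => ?_) hR
    have h1 := tendsto_div_quad (level k)
    simpa using ((h1.pow (s + 2)).const_mul (Real.exp (φ (level k)))).mul_const (pop (ρ t) k)
  have h0 : ∀ k : Occ n, 0 ≤ Real.exp (φ (level k)) * pop (ρ t) k :=
    fun k => mul_nonneg (Real.exp_pos _).le (hp t ht k)
  have hs := summable_of_sum_le h0 key
  exact ⟨hs, hs.tsum_le_of_sum_le key⟩

end solution

/-! ### Finite moments in terms of populations -/

/-- The occupation number only increases under creation, so every factor is at least the first one.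
-/
theorem creation_pow_numVec (i : Fin n) (k : Occ n) (m : ℕ) :
    ∃ (c : ℝ) (l : Occ n), Real.sqrt (k i + 1) ^ m ≤ c ∧ k i ≤ l i ∧
      (creation i ^ m : Module.End ℂ (FinVec n)) (numVec k) = (c : ℂ) • numVec l := by
  induction m with
  | zero => exact ⟨1, k, by simp, le_rfl, by simp⟩
  | succ m ih =>
    obtain ⟨c, l, hc, hl, h⟩ := ih
    have hl' : (k i : ℝ) ≤ l i := by exact_mod_cast hl
    refine ⟨c * Real.sqrt (l i + 1), l + Pi.single i 1, ?_, by simp; omega, ?_⟩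
    · rw [pow_succ]
      have : 0 ≤ c := (by positivity : (0 : ℝ) ≤ Real.sqrt (k i + 1) ^ m).trans hc
      gcongr
    · rw [pow_succ', Module.End.mul_apply, h, map_smul, creation_numVec', smul_smul]
      push_cast
      rfl

theorem sqrt_pow_le_norm_monomial (i : Fin n) (k : Occ n) (m : ℕ) :
    Real.sqrt (k i + 1) ^ m ≤
      ‖incl n (monomial (fun _ : Fin m => Sum.inr i) (numVec k))‖ := by
  obtain ⟨c, l, hc, -, h⟩ := creation_pow_numVec i k m
  have : monomial (fun _ : Fin m => (Sum.inr i : Idx n)) = creation i ^ m := by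
    rw [monomial, List.ofFn_const, List.prod_replicate]
    rfl
  rw [this, h, map_smul, norm_smul, norm_incl_numVec, mul_one, Complex.norm_real]
  exact hc.trans (le_abs_self c)

/-- The total number is at most `n` times the largest occupation number. The summand 1 covers the
case of no modes. -/
theorem wt_pow_le_sum (k : Occ n) (m : ℕ) :
    wt k ^ m ≤ 1 + (n : ℝ) ^ m * ∑ i, Real.sqrt (k i + 1) ^ m := by
  rcases isEmpty_or_nonempty (Fin n) with h | h
  · have : wt k = 1 := by simp [wt, level]
    simp [this]
  · obtain ⟨i, hi⟩ := Finite.exists_max k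
    have hn : 1 ≤ n := Fin.pos_iff_nonempty.2 h
    have hn' : (1 : ℝ) ≤ n := by exact_mod_cast hn
    have h1 : (level k : ℝ) ≤ n * k i := by
      have : level k ≤ ∑ _j : Fin n, (k i : ℤ) :=
        Finset.sum_le_sum fun j _ => by exact_mod_cast hi j
      rw [Finset.sum_const, Finset.card_univ, Fintype.card_fin, nsmul_eq_mul] at this
      exact_mod_cast this
    have h2 : wt k ≤ n * Real.sqrt (k i + 1) := by
      rw [wt]
      refine Real.sqrt_le_iff.2 ⟨by positivity, ?_⟩
      rw [mul_pow, Real.sq_sqrt (by positivity)]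
      have h3 : (n : ℝ) * 1 ≤ n * n := by gcongr
      have h4 : (0 : ℝ) ≤ k i + 1 := by positivity
      nlinarith [mul_le_mul_of_nonneg_right h3 h4]
    have h3 : Real.sqrt (k i + 1) ^ m ≤ ∑ i, Real.sqrt (k i + 1) ^ m :=
      Finset.single_le_sum (f := fun i => Real.sqrt (k i + 1) ^ m)
        (fun _ _ => by positivity) (Finset.mem_univ i)
    calc wt k ^ m ≤ (n * Real.sqrt (k i + 1)) ^ m := pow_le_pow_left₀ (wt_pos k).le h2 m
      _ = (n : ℝ) ^ m * Real.sqrt (k i + 1) ^ m := mul_pow _ _ _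
      _ ≤ (n : ℝ) ^ m * ∑ i, Real.sqrt (k i + 1) ^ m := by gcongr
      _ ≤ _ := by linarith

/-- All moments of order `m` reduce to one weighted sum of populations: powers of single creation
operators already dominate the weight, and every word of length `m` is dominated by it. -/
theorem IsDensityMatrix.finiteMoments_iff {ρ : Fock n →L[ℂ] Fock n} (hρ : IsDensityMatrix ρ)
    (m : ℕ) : FiniteMoments m ρ ↔ Summable fun k => wt k ^ m * pop ρ k := by
  constructor
  · intro h
    have h1 : Summable fun k : Occ n => pop ρ k + (n : ℝ) ^ m * ∑ i : Fin n,
        ‖incl n (monomial (fun _ : Fin m => Sum.inr i) (numVec k))‖ * pop ρ k :=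
      hρ.hasSum_pop.summable.add ((summable_sum fun i _ => h fun _ => Sum.inr i).mul_left _)
    refine Summable.of_nonneg_of_le
      (fun k => mul_nonneg (pow_nonneg (wt_pos k).le m) (hρ.pop_nonneg k)) (fun k => ?_) h1
    refine (mul_le_mul_of_nonneg_right (wt_pow_le_sum k m) (hρ.pop_nonneg k)).trans ?_
    rw [add_mul, one_mul, mul_assoc, Finset.sum_mul]
    gcongr with i
    · exact hρ.pop_nonneg k
    · exact sqrt_pow_le_norm_monomial i k m
  · intro h I
    obtain ⟨c, B, hc, hB, hI⟩ := hasOrder_monomial I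
    refine Summable.of_nonneg_of_le
      (fun k => mul_nonneg (norm_nonneg _) (hρ.pop_nonneg k)) (fun k => ?_) (h.mul_left c)
    rw [← mul_assoc]
    exact mul_le_mul_of_nonneg_right ((norm_incl_le _).trans (hI k).1) (hρ.pop_nonneg k)

theorem IsDensityMatrix.summable_traceTerm {ρ : Fock n →L[ℂ] Fock n} (hρ : IsDensityMatrix ρ)
    {m : ℕ} (h : Summable fun k => wt k ^ m * pop ρ k) (I : Fin m → Idx n) :
    Summable (traceTerm ρ I) := by
  obtain ⟨c, B, hc, hB, hI⟩ := hasOrder_monomial I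
  obtain ⟨c', B', hc', hB', hI'⟩ := hasOrder_monomialAdj I
  refine hρ.summable_inner_adj (isAdj_monomial I).symm (g := fun k => (c + c') * wt k ^ m)
    (fun k => (hI' k).1.trans ?_) (fun k => (hI k).1.trans ?_)
    (by simpa only [mul_assoc] using h.mul_left (c + c'))
  · have := pow_nonneg (wt_pos k).le m
    nlinarith
  · have := pow_nonneg (wt_pos k).le m
    nlinarith

/-- A smooth weight comparable to the `m`-th power of `wt`. -/
def momentExp (m : ℕ) (x : ℤ) : ℝ := (m / 4 : ℝ) * Real.log (quad 1 x)

theorem wt_pow_four (k : Occ n) : wt k ^ 4 = br (level k) ^ 2 := by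
  rw [← wt_sq_eq_br]
  ring

/-- Explains the quotient m/4 in `momentExp`: the fourth power of `wt` is (N+1)², which is
comparable to N²+1. -/
theorem exp_log_wt (k : Occ n) (m : ℕ) : Real.exp ((m / 4 : ℝ) * Real.log (wt k ^ 4)) =
    wt k ^ m := by
  rw [Real.log_pow, show (m / 4 : ℝ) * ((4 : ℕ) * Real.log (wt k)) = m * Real.log (wt k) by
    push_cast; ring, Real.exp_nat_mul, Real.exp_log (wt_pos k)]

theorem exp_momentExp_le (k : Occ n) (m : ℕ) : Real.exp (momentExp m (level k)) ≤ wt k ^ m := by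
  rw [← exp_log_wt, momentExp, wt_pow_four]
  have := quad_pos le_rfl (level k)
  gcongr
  exact quad_one_le_br_sq _

theorem wt_pow_le_exp (k : Occ n) (m : ℕ) :
    wt k ^ m ≤ Real.exp (m / 4 * Real.log 2) * Real.exp (momentExp m (level k)) := by
  rw [← exp_log_wt, momentExp, wt_pow_four, ← Real.exp_add, ← mul_add,
    ← Real.log_mul two_ne_zero (quad_pos le_rfl _).ne']
  have : 0 < br (level k) := zero_lt_one.trans_le (one_le_br _)
  gcongr
  exact br_sq_le _

theorem exp_momentExp_le_quad (m : ℕ) (x : ℤ) :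
    Real.exp (momentExp m x) ≤ 1 * quad 1 x ^ m := by
  have h := quad_pos le_rfl x
  rw [one_mul, momentExp, ← Real.exp_log (pow_pos h m), Real.log_pow]
  have h1 : 0 ≤ Real.log (quad 1 x) := Real.log_nonneg (one_le_quad_one x)
  have h2 : (0 : ℝ) ≤ m := by positivity
  refine Real.exp_le_exp.2 ?_
  nlinarith [mul_nonneg h2 h1]

/-! ### Propagation of moments and of their tails -/

section solution

variable {N : ℕ} {K : Fin N → Matrix (Idx n) (Idx n) ℂ} {ρ : ℝ → (Fock n →L[ℂ] Fock n)}

theorem logSym_momentExp {c : ℝ}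
    (hlog : LogSym (fun x => c * (quad 1 x / quad 1 x)) (fun x => Real.log (quad 1 x))) (m : ℕ) :
    LogSym (fun _ => m / 4 * c) (momentExp m) := by
  refine (hlog.mul_left (m / 4 : ℝ)).mono fun x => ?_
  rw [div_self (quad_pos le_rfl x).ne', abs_of_nonneg (by positivity), mul_one]

theorem IsSolution.exists_tsum_momentExp_le (hρ : IsSolution (fun j => quadOp (K j)) ρ)
    (hC : ∀ j, IsAdj (quadOp (K j)) (quadOp (K j))) {m : ℕ}
    (h0 : Summable fun k : Occ n => wt k ^ m * pop (ρ 0) k) (t : ℝ) :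
    ∃ M, ∀ s ∈ Set.Icc 0 t,
      (Summable fun k : Occ n => Real.exp (momentExp m (level k)) * pop (ρ s) k) ∧
      ∑' k : Occ n, Real.exp (momentExp m (level k)) * pop (ρ s) k ≤ M := by
  obtain ⟨c₀, hc₀, hlog⟩ := logSym_log_quad
  obtain ⟨Λ, hΛ, H⟩ := hρ.exists_summable_exp hC (c := m / 4 * c₀) (by positivity) m
  have hp := (hρ.isDensityMatrix 0 le_rfl).pop_nonneg
  have hsum : Summable fun k : Occ n => Real.exp (momentExp m (level k)) * pop (ρ 0) k :=
    Summable.of_nonneg_of_le (fun k => mul_nonneg (Real.exp_pos _).le (hp k))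
      (fun k => mul_le_mul_of_nonneg_right (exp_momentExp_le k m) (hp k)) h0
  refine ⟨Real.exp (Λ * t) * ∑' k : Occ n, Real.exp (momentExp m (level k)) * pop (ρ 0) k,
    fun s hs => ?_⟩
  obtain ⟨h1, h2⟩ := H _ (logSym_momentExp (hlog 1 le_rfl) m) 1 (exp_momentExp_le_quad m) hsum
    s hs.1
  refine ⟨h1, h2.trans (mul_le_mul_of_nonneg_right ?_ ?_)⟩
  · exact Real.exp_le_exp.2 (mul_le_mul_of_nonneg_left hs.2 hΛ)
  · exact tsum_nonneg fun k => mul_nonneg (Real.exp_pos _).le (hp k)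

theorem IsSolution.summable_wt (hρ : IsSolution (fun j => quadOp (K j)) ρ)
    (hC : ∀ j, IsAdj (quadOp (K j)) (quadOp (K j))) {m : ℕ}
    (h0 : Summable fun k : Occ n => wt k ^ m * pop (ρ 0) k) {t : ℝ} (ht : 0 ≤ t) :
    Summable fun k : Occ n => wt k ^ m * pop (ρ t) k := by
  obtain ⟨M, hM⟩ := hρ.exists_tsum_momentExp_le hC h0 t
  have hp := (hρ.isDensityMatrix t ht).pop_nonneg
  refine Summable.of_nonneg_of_le
    (fun k => mul_nonneg (pow_nonneg (wt_pos k).le m) (hp k)) (fun k => ?_)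
    ((hM t ⟨ht, le_rfl⟩).1.mul_left (Real.exp (m / 4 * Real.log 2)))
  rw [← mul_assoc]
  exact mul_le_mul_of_nonneg_right (wt_pow_le_exp k m) (hp k)

/-- The extra factor is at most 1 and tends to 0 pointwise as R grows, so at time 0 the sum tends to
0 by dominated convergence. The logarithm of the whole weight satisfies `LogSym` with a constant
free of `R`, so up to time t the sum grows by a factor independent of `R`. -/
theorem IsSolution.exists_tsum_tail_le (hρ : IsSolution (fun j => quadOp (K j)) ρ)
    (hC : ∀ j, IsAdj (quadOp (K j)) (quadOp (K j))) {m : ℕ}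
    (h0 : Summable fun k : Occ n => wt k ^ m * pop (ρ 0) k) (t : ℝ) :
    ∃ d : ℝ → ℝ, Tendsto d atTop (𝓝 0) ∧ ∀ R, 1 ≤ R → ∀ s ∈ Set.Icc 0 t,
      (Summable fun k : Occ n => Real.exp (momentExp m (level k)) *
        (quad 1 (level k) / quad R (level k)) * pop (ρ s) k) ∧
      ∑' k : Occ n, Real.exp (momentExp m (level k)) *
        (quad 1 (level k) / quad R (level k)) * pop (ρ s) k ≤ d R := by
  obtain ⟨c₀, hc₀, hlog⟩ := logSym_log_quad
  obtain ⟨Λ, hΛ, H⟩ := hρ.exists_summable_exp hC (c := m / 4 * c₀ + (1 * c₀ + 1 * c₀))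
    (by positivity) m
  have hp := (hρ.isDensityMatrix 0 le_rfl).pop_nonneg
  have hsum : Summable fun k : Occ n => Real.exp (momentExp m (level k)) * pop (ρ 0) k :=
    Summable.of_nonneg_of_le (fun k => mul_nonneg (Real.exp_pos _).le (hp k))
      (fun k => mul_le_mul_of_nonneg_right (exp_momentExp_le k m) (hp k)) h0
  have hratio : ∀ R : ℝ, 1 ≤ R → ∀ x, quad 1 x / quad R x ≤ 1 := fun R hR x =>
    (div_le_one (quad_pos hR x)).2 (quad_one_le hR x)
  have hratio0 : ∀ R : ℝ, 1 ≤ R → ∀ x, 0 ≤ quad 1 x / quad R x := fun R hR x =>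
    (div_pos (quad_pos le_rfl x) (quad_pos hR x)).le
  have hle : ∀ R : ℝ, 1 ≤ R → ∀ x, Real.exp (momentExp m x) * (quad 1 x / quad R x) ≤
      Real.exp (momentExp m x) := fun R hR x =>
    mul_le_of_le_one_right (Real.exp_pos _).le (hratio R hR x)
  refine ⟨fun R => Real.exp (Λ * t) * ∑' k : Occ n, Real.exp (momentExp m (level k)) *
        (quad 1 (level k) / quad R (level k)) * pop (ρ 0) k, ?_, fun R hR s hs => ?_⟩
  · rw [← mul_zero (Real.exp (Λ * t))]
    refine Tendsto.const_mul _ ?_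
    have := tendsto_tsum_of_dominated_convergence (𝓕 := (atTop : Filter ℝ))
      (f := fun R (k : Occ n) => Real.exp (momentExp m (level k)) *
        (quad 1 (level k) / quad R (level k)) * pop (ρ 0) k) (g := fun _ => 0) hsum
      (fun k => by
        simpa using ((tendsto_const_div_quad (quad 1 (level k)) (level k)).const_mul
          (Real.exp (momentExp m (level k)))).mul_const (pop (ρ 0) k))
      (by
        filter_upwards [eventually_ge_atTop 1] with R hR k
        rw [Real.norm_of_nonneg
          (mul_nonneg (mul_nonneg (Real.exp_pos _).le (hratio0 R hR _)) (hp k))]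
        exact mul_le_mul_of_nonneg_right (hle R hR _) (hp k))
    simpa using this
  · have hexp : ∀ x, Real.exp (momentExp m x + (1 * Real.log (quad 1 x) +
        (-1) * Real.log (quad R x))) =
        Real.exp (momentExp m x) * (quad 1 x / quad R x) := fun x => by
      rw [Real.exp_add, one_mul, neg_one_mul, ← sub_eq_add_neg, Real.exp_sub,
        Real.exp_log (quad_pos le_rfl x), Real.exp_log (quad_pos hR x)]
    have hsym : LogSym (fun _ => m / 4 * c₀ + (1 * c₀ + 1 * c₀))
        (fun x => momentExp m x + (1 * Real.log (quad 1 x) + (-1) * Real.log (quad R x))) := by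
      refine ((logSym_momentExp (hlog 1 le_rfl) m).add
        (((hlog 1 le_rfl).mul_left 1).add ((hlog R hR).mul_left (-1)))).mono fun x => ?_
      rw [abs_neg, abs_one]
      have h1 := mul_le_of_le_one_right hc₀ (hratio 1 le_rfl x)
      have h2 := mul_le_of_le_one_right hc₀ (hratio R hR x)
      linarith
    have h1 := H _ hsym 1 (fun x => by
        rw [hexp]
        exact (hle R hR x).trans (exp_momentExp_le_quad m x))
      (by
        simp only [hexp]
        exact Summable.of_nonneg_of_le
          (fun k => mul_nonneg (mul_nonneg (Real.exp_pos _).le (hratio0 R hR _)) (hp k))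
          (fun k => mul_le_mul_of_nonneg_right (hle R hR _) (hp k)) hsum) s hs.1
    simp only [hexp] at h1
    refine ⟨h1.1, h1.2.trans (mul_le_mul_of_nonneg_right ?_ ?_)⟩
    · exact Real.exp_le_exp.2 (mul_le_mul_of_nonneg_left hs.2 hΛ)
    · exact tsum_nonneg fun k =>
        mul_nonneg (mul_nonneg (Real.exp_pos _).le (hratio0 R hR _)) (hp k)

end solution

/-! ### Cutoff functions -/

/-- The bound on the differences of the cutoff functions. -/
def cutBound (a R ε : ℝ) (x : ℤ) : ℝ := a * (quad 1 x / quad R x) + ε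

/-- The functions are (R/(x²+R))² with R = i + 1, cut sharply far out. The differences of their
logarithms carry the factor (x²+1)/(x²+R), small as long as x² is small against R, and the sharp cut
costs at most 1/(i+1). The square provides the decay that `eventually_cut` asks for. -/
theorem exists_cutoffs : ∃ a : ℝ, 0 ≤ a ∧ ∃ f : ℕ → ℤ → ℝ,
    (∀ i, ∃ L, ∀ x, L < x → f i x = 0) ∧ (∀ i x, |f i x| ≤ 1) ∧
    (∀ x, 0 ≤ x → Tendsto (fun i => f i x) atTop (𝓝 1)) ∧
    (∀ i (x b : ℤ), 0 ≤ x → |b| ≤ 2 →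
      br x * |diff b (f i) x| ≤ cutBound a (i + 1) (1 / (i + 1)) x) ∧
    (∀ i (x b c : ℤ), 0 ≤ x → |b| ≤ 2 → |c| ≤ 2 →
      br x ^ 2 * |diff b (diff c (f i)) x| ≤ cutBound a (i + 1) (1 / (i + 1)) x) := by
  obtain ⟨c₀, hc₀, hlog⟩ := logSym_log_quad
  set c := 2 * c₀ with hc
  set A := (c + 1) * Real.exp (3 * c) * c with hA
  have hc0 : 0 ≤ c := by positivity
  set g : ℕ → ℤ → ℝ := fun i x =>
    Real.exp (2 * (Real.log (i + 1) - Real.log (quad (i + 1) x))) with hg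
  have hR : ∀ i : ℕ, (1 : ℝ) ≤ i + 1 := fun i => by linarith [Nat.cast_nonneg (α := ℝ) i]
  have hgeq : ∀ i x, g i x = ((i + 1 : ℝ) / quad (i + 1) x) ^ 2 := fun i x => by
    have h1 := quad_pos (hR i) x
    have h2 : (0 : ℝ) < i + 1 := by positivity
    simp only [hg]
    rw [← Real.log_div h2.ne' h1.ne', show (2 : ℝ) = (2 : ℕ) by norm_num, Real.exp_nat_mul,
      Real.exp_log (by positivity)]
  have hg0 : ∀ i x, 0 ≤ g i x := fun i x => (Real.exp_pos _).le
  have hg1 : ∀ i x, g i x ≤ 1 := fun i x => by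
    rw [hgeq]
    have h1 := quad_pos (hR i) x
    refine pow_le_one₀ (by positivity) ((div_le_one h1).2 ?_)
    rw [quad]
    nlinarith [sq_nonneg (x : ℝ)]
  have hsym : ∀ i : ℕ, LogSym (fun x => c * (quad 1 x / quad (i + 1) x))
      (fun x => 2 * (Real.log (i + 1) - Real.log (quad (i + 1) x))) := fun i =>
    (((hlog _ (hR i)).const_sub (Real.log (i + 1))).mul_left 2).mono fun x => by
      rw [abs_two, hc, mul_assoc]
  have hle : ∀ (i : ℕ) x, c * (quad 1 x / quad (i + 1) x) ≤ c := fun i x =>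
    mul_le_of_le_one_right hc0 ((div_le_one (quad_pos (hR i) x)).2 (quad_one_le (hR i) x))
  have hlim : ∀ i, Tendsto (fun x => br x ^ 2 * g i x) atTop (𝓝 0) := fun i => by
    have hbound : ∀ x : ℤ, br x ^ 2 * g i x ≤ 2 * (i + 1 : ℝ) ^ 2 * (quad 1 x)⁻¹ := fun x => by
      have h1 := quad_pos le_rfl x
      have h2 := quad_pos (hR i) x
      rw [hgeq]
      calc br x ^ 2 * ((i + 1 : ℝ) / quad (i + 1) x) ^ 2
          ≤ (2 * quad 1 x) * ((i + 1 : ℝ) / quad 1 x) ^ 2 := by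
            gcongr
            · exact br_sq_le x
            · exact quad_one_le (hR i) x
        _ = _ := by
          rw [div_pow]
          field_simp
    refine squeeze_zero (fun x => mul_nonneg (sq_nonneg _) (hg0 i x)) hbound ?_
    suffices h : Tendsto (fun x : ℤ => quad 1 x) atTop atTop by
      have := (tendsto_inv_atTop_zero.comp h).const_mul (2 * (i + 1 : ℝ) ^ 2)
      rwa [mul_zero] at this
    refine tendsto_atTop_mono (f := fun x : ℤ => (x : ℝ)) (fun x => ?_)
      tendsto_intCast_atTop_atTop
    rw [quad]
    nlinarith [sq_nonneg ((x : ℝ) - 1)]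
  -- The condition that the cut lies at or beyond `i` ensures that at each fixed x it is eventually
  -- not felt.
  have hex : ∀ i : ℕ, ∃ L : ℤ, (i : ℤ) ≤ L ∧ ∀ x : ℤ, 0 ≤ x →
      (∀ a : ℤ, |a| ≤ 2 → br x * |diff a (cut L (g i)) x| ≤
        cut L (fun x => br x * |diff a (g i) x|) x + 1 / (i + 1)) ∧
      (∀ a b : ℤ, |a| ≤ 2 → |b| ≤ 2 → br x ^ 2 * |diff a (diff b (cut L (g i))) x| ≤
        cut L (fun x => br x ^ 2 * |diff a (diff b (g i)) x|) x + 1 / (i + 1)) := fun i =>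
    ((eventually_ge_atTop (i : ℤ)).and
      (eventually_cut (hg0 i) (hlim i) (by positivity : (0 : ℝ) < 1 / (i + 1)))).exists
  choose L hLi hL using hex
  have hcut : ∀ (i : ℕ) (q : ℤ → ℝ), (∀ x, 0 ≤ q x) →
      (∀ x, q x ≤ (c + 1) * Real.exp (3 * c) * (c * (quad 1 x / quad (i + 1) x)) * g i x) →
      ∀ x, cut (L i) q x + 1 / (i + 1) ≤ cutBound A (i + 1) (1 / (i + 1)) x :=
    fun i q hq0 hq x => by
      have h1 : 0 ≤ quad 1 x / quad (i + 1) x :=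
        (div_pos (quad_pos le_rfl x) (quad_pos (hR i) x)).le
      rw [cutBound]
      refine add_le_add_left ((cut_le hq0 _ x).trans ((hq x).trans ?_)) _
      rw [hA, mul_assoc _ c]
      exact mul_le_of_le_one_right (by positivity) (hg1 i x)
  refine ⟨A, by positivity, fun i => cut (L i) (g i), fun i => ⟨L i, fun x hx => cut_of_lt hx _⟩,
    fun i x => ?_, fun x hx => ?_, fun i x b hx hb => ?_, fun i x b d hx hb hd => ?_⟩
  · rw [abs_of_nonneg (cut_nonneg (hg0 i) _ x)]
    exact (cut_le (hg0 i) _ x).trans (hg1 i x)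
  · have h1 : Tendsto (fun i : ℕ => ((i + 1 : ℝ) / quad (i + 1) x) ^ 2) atTop (𝓝 1) := by
      have := ((tendsto_div_quad x).comp
        (tendsto_atTop_add_const_right atTop (1 : ℝ) tendsto_natCast_atTop_atTop)).pow 2
      simpa using this
    refine h1.congr' ?_
    filter_upwards [eventually_ge_atTop x.toNat] with i hi
    rw [cut_of_le (by have := hLi i; omega), hgeq]
  · refine ((hL i x hx).1 b hb).trans (hcut i _ (fun x => mul_nonneg
      (zero_le_one.trans (one_le_br x)) (abs_nonneg _)) (fun x => ?_) x)
    refine ((hsym i).first_exp (hle i) x b hb).trans ?_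
    have h0 := (hsym i).nonneg x
    have h1 : Real.exp c ≤ (c + 1) * Real.exp (3 * c) := by
      have : Real.exp c ≤ Real.exp (3 * c) := Real.exp_le_exp.2 (by linarith)
      nlinarith [Real.exp_pos (3 * c)]
    exact mul_le_mul_of_nonneg_right (mul_le_mul_of_nonneg_right h1 h0) (hg0 i x)
  · exact ((hL i x hx).2 b d hb hd).trans (hcut i _ (fun x => mul_nonneg
      (sq_nonneg _) (abs_nonneg _)) (fun x => (hsym i).second_exp (hle i) x b d hb hd) x)

/-! ### Commutators of quadratic operators with truncated words -/

theorem comm_comm_mul {A : Type*} [Ring A] (c f a : A) :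
    c * (c * (f * a) - f * a * c) - (c * (f * a) - f * a * c) * c =
      f * (c * (c * a - a * c) - (c * a - a * c) * c) +
      ((c * f - f * c) * (c * a - a * c) + (c * f - f * c) * (c * a - a * c) +
        (c * (c * f - f * c) - (c * f - f * c) * c) * a) := by noncomm_ring

theorem cutBound_nonneg {a R ε : ℝ} (ha : 0 ≤ a) (hR : 1 ≤ R) (hε : 0 ≤ ε) (x : ℤ) :
    0 ≤ cutBound a R ε x := by
  have h1 := quad_pos hR x
  have h2 := quad_pos le_rfl x
  rw [cutBound]
  positivity

/-- A bounded shift of the number changes the bound by a constant factor only, so it can be carried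
past an operator that has an order in the sense of `HasOrder`. -/
theorem cutBound_le {a R ε B : ℝ} (ha : 0 ≤ a) (hR : 1 ≤ R) (hε : 0 ≤ ε) {x y : ℤ}
    (hxy : |(y : ℝ) - x| ≤ B) :
    cutBound a R ε y ≤ (2 * B ^ 2 + 2) ^ 2 * cutBound a R ε x := by
  have h1 := quad_pos hR x
  have h2 := quad_pos hR y
  have h3 := quad_pos le_rfl x
  have h4 := quad_le_mul_quad_add hR x (y - x) (B := B) (by push_cast; exact hxy)
  have h5 := quad_le_mul_quad_add le_rfl y (x - y) (B := B) (by
    push_cast; rwa [abs_sub_comm])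
  rw [add_sub_cancel] at h4 h5
  have h6 : quad 1 y / quad R y ≤ (2 * B ^ 2 + 2) ^ 2 * (quad 1 x / quad R x) := by
    rw [div_le_iff₀ h2]
    calc quad 1 y ≤ (2 * B ^ 2 + 2) * quad 1 x := h5
      _ = (2 * B ^ 2 + 2) * (quad 1 x / quad R x) * quad R x := by field_simp
      _ ≤ (2 * B ^ 2 + 2) * (quad 1 x / quad R x) * ((2 * B ^ 2 + 2) * quad R y) := by gcongr
      _ = _ := by ring
  have h7 : ε ≤ (2 * B ^ 2 + 2) ^ 2 * ε := by
    refine le_mul_of_one_le_left hε (one_le_pow₀ ?_)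
    nlinarith [sq_nonneg B]
  rw [cutBound, cutBound, mul_add, mul_left_comm]
  exact add_le_add (mul_le_mul_of_nonneg_left h6 ha) h7

theorem HasOrder.exists_l1_mul_le {Z : Module.End ℂ (FinVec n)} {d : ℕ} (hZ : HasOrder d Z) :
    ∃ c, 0 ≤ c ∧ ∀ (Y : Module.End ℂ (FinVec n)) (b a R ε : ℝ), 0 ≤ b → 0 ≤ a → 1 ≤ R → 0 ≤ ε →
      (∀ k, l1 (Y (numVec k)) ≤ b * cutBound a R ε (level k)) →
      ∀ k, l1 ((Y * Z : Module.End ℂ (FinVec n)) (numVec k)) ≤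
        c * b * (wt k ^ d * cutBound a R ε (level k)) := by
  obtain ⟨c, B, hc, hB, h⟩ := hZ
  refine ⟨c * (2 * B ^ 2 + 2) ^ 2, by positivity, fun Y b a R ε hb ha hR hε hY k => ?_⟩
  rw [Module.End.mul_apply]
  have hη := cutBound_nonneg ha hR hε (level k)
  have h1 := l1_apply_le_mul (X := Y) (v := Z (numVec k))
    (c := b * ((2 * B ^ 2 + 2) ^ 2 * cutBound a R ε (level k))) fun p hp =>
      (hY p).trans (mul_le_mul_of_nonneg_left (cutBound_le ha hR hε ((h k).2 p hp)) hb)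
  refine h1.trans ((mul_le_mul_of_nonneg_right (h k).1 (by positivity)).trans_eq ?_)
  ring

/-- The terms of the double commutator `[C, [C, f(N) X]]` in which `f` is differentiated. -/
def cutError (C X : Module.End ℂ (FinVec n)) (f : ℤ → ℝ) : Module.End ℂ (FinVec n) :=
  comm C (diag f) * comm C X + comm C (diag f) * comm C X + comm C (comm C (diag f)) * X

theorem comm_comm_diag_mul (C X : Module.End ℂ (FinVec n)) (f : ℤ → ℝ) :
    comm C (comm C (diag f * X)) = diag f * comm C (comm C X) + cutError C X f :=
  comm_comm_mul C (diag f) X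

theorem IsFin.cutError {C X X' : Module.End ℂ (FinVec n)} {f : ℤ → ℝ} (hC : IsAdj C C)
    (hX : IsAdj X X') (hf : IsFin (diag f : Module.End ℂ (FinVec n))) :
    IsFin (cutError C X f) := by
  have h1 := (hf.comm hC).mul_right ⟨_, hC.commutator hX⟩
  exact (h1.add h1).add (((hf.comm hC).comm hC).mul_right ⟨_, hX⟩)

/-- Bound on the error terms caused by a cutoff function. -/
theorem exists_norm_tr_cutError_le {K : Matrix (Idx n) (Idx n) ℂ} {d : ℕ}
    {X X' : Module.End ℂ (FinVec n)} (hC : IsAdj (quadOp K) (quadOp K)) (hX : IsAdj X X')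
    (hXd : HasOrder d X) (hXd' : HasOrder d X') (hXc : HasOrder d (comm (quadOp K) X))
    (hXc' : HasOrder d (comm (quadOp K) X')) :
    ∃ c, 0 ≤ c ∧ ∀ (a R ε : ℝ), 0 ≤ a → 1 ≤ R → 0 ≤ ε → ∀ f : ℤ → ℝ,
      IsFin (diag f : Module.End ℂ (FinVec n)) →
      (∀ x b : ℤ, 0 ≤ x → |b| ≤ 2 → br x * |diff b f x| ≤ cutBound a R ε x) →
      (∀ x b b' : ℤ, 0 ≤ x → |b| ≤ 2 → |b'| ≤ 2 →
        br x ^ 2 * |diff b (diff b' f) x| ≤ cutBound a R ε x) →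
      ∀ ρ : Fock n →L[ℂ] Fock n, IsDensityMatrix ρ →
      (Summable fun k : Occ n => wt k ^ d * cutBound a R ε (level k) * pop ρ k) →
      ‖tr ρ (cutError (quadOp K) X f)‖ ≤
        c * ∑' k : Occ n, wt k ^ d * cutBound a R ε (level k) * pop ρ k := by
  -- Schur's test needs the columns of the operator and of its adjoint. In the former the
  -- commutators with `diag f` stand on the left (`H3`, `H4`, fed by `H1`, `H2`), in the latter on
  -- the right (`H5`, `H6`).
  obtain ⟨c1, hc1, H1⟩ := HasOrder.one.exists_l1_mul_commutator_diag_le K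
  obtain ⟨c2, hc2, H2⟩ := HasOrder.one.exists_l1_mul_double_commutator_diag_le K
  obtain ⟨c3, hc3, H3⟩ := hXc.exists_l1_mul_le
  obtain ⟨c4, hc4, H4⟩ := hXd.exists_l1_mul_le
  obtain ⟨c5, hc5, H5⟩ := hXc'.exists_l1_mul_commutator_diag_le K
  obtain ⟨c6, hc6, H6⟩ := hXd'.exists_l1_mul_double_commutator_diag_le K
  refine ⟨2 * c3 * c1 + c4 * c2 + (2 * c5 + c6), by positivity,
    fun a R ε ha hR hε f hf hf1 hf2 ρ hρ hs => ?_⟩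
  set η : Occ n → ℝ := fun k => cutBound a R ε (level k) with hη
  have g1 : ∀ (k : Occ n) (b : ℤ), |b| ≤ 2 →
      ((level k : ℝ) + 1) * |diff b f (level k)| ≤ η k := fun k b hb => by
    rw [← br_level]; exact hf1 _ b (level_nonneg k) hb
  have g2 : ∀ (k : Occ n) (b b' : ℤ), |b| ≤ 2 → |b'| ≤ 2 →
      ((level k : ℝ) + 1) ^ 2 * |diff b (diff b' f) (level k)| ≤ η k := fun k b b' hb hb' => by
    rw [← br_level]; exact hf2 _ b b' (level_nonneg k) hb hb'
  have e1 : ∀ k, l1 (comm (quadOp K) (diag f) (numVec k)) ≤ c1 * η k := fun k => by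
    simpa only [one_mul, pow_zero] using H1 f k (η k) (g1 k)
  have e2 : ∀ k, l1 (comm (quadOp K) (comm (quadOp K) (diag f)) (numVec k)) ≤ c2 * η k :=
    fun k => by simpa only [one_mul, pow_zero] using H2 f k (η k) (g1 k) (g2 k)
  have hw : ∀ k : Occ n, 0 ≤ wt k ^ d * η k := fun k =>
    mul_nonneg (pow_nonneg (wt_pos k).le d) (cutBound_nonneg ha hR hε _)
  have hadj : IsAdj (cutError (quadOp K) X f)
      (comm (quadOp K) X' * comm (quadOp K) (diag f) + comm (quadOp K) X' * comm (quadOp K) (diag f)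
        + X' * comm (quadOp K) (comm (quadOp K) (diag f))) := by
    have k1 := (hC.commutator (isAdj_diag f)).mul (hC.commutator hX)
    have k2 : (X' * quadOp K - quadOp K * X') * (diag f * quadOp K - quadOp K * diag f) =
        comm (quadOp K) X' * comm (quadOp K) (diag f) := by
      rw [comm, comm, ← neg_sub (quadOp K * X'), ← neg_sub (quadOp K * diag f), neg_mul_neg]
    rw [k2] at k1
    exact (k1.add k1).add ((hC.comm_comm (isAdj_diag f)).mul hX)
  rw [← tsum_mul_left]
  simp only [← mul_assoc]
  have hs' := hs.mul_left (2 * c3 * c1 + c4 * c2 + (2 * c5 + c6))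
  have hsum : Summable fun k : Occ n => (2 * c3 * c1 + c4 * c2 + (2 * c5 + c6)) *
      wt k ^ d * cutBound a R ε (level k) * pop ρ k := by
    simpa only [← mul_assoc] using hs'
  refine hρ.norm_tr_le hadj (IsFin.cutError hC hX hf) (fun k => ?_) (fun k => ?_) hsum
  · have t1 := H3 _ c1 a R ε hc1 ha hR hε e1 k
    have t2 := H4 _ c2 a R ε hc2 ha hR hε e2 k
    rw [cutError, LinearMap.add_apply, LinearMap.add_apply]
    have t3 := (l1_add_le _ _).trans (add_le_add ((l1_add_le _ _).trans (add_le_add t1 t1)) t2)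
    refine t3.trans ?_
    have := hw k
    have h8 : 0 ≤ (2 * c5 + c6) * (wt k ^ d * η k) := by positivity
    simp only [hη] at h8
    linarith
  · have t1 := H5 f k (η k) (g1 k)
    have t2 := H6 f k (η k) (g1 k) (g2 k)
    rw [LinearMap.add_apply, LinearMap.add_apply]
    have t3 := (l1_add_le _ _).trans (add_le_add ((l1_add_le _ _).trans (add_le_add t1 t1)) t2)
    refine t3.trans ?_
    have := hw k
    have h8 : 0 ≤ (2 * c3 * c1 + c4 * c2) * (wt k ^ d * η k) := by positivity
    simp only [hη] at h8 ⊢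
    linarith

/-- The order is `m` and not `m + 2`, as the commutator is a combination of words of length `m`.
Hence moments of order `m` suffice to control the errors. -/
theorem hasOrder_comm_monomial {m : ℕ} {K : Matrix (Idx n) (Idx n) ℂ} (hs : Kᵀ = K)
    (I : Fin m → Idx n) : HasOrder m (comm (quadOp K) (monomial I)) := by
  rw [quadOp_commutator_monomial hs]
  exact HasOrder.sum _ fun I' => (hasOrder_monomial I').smul _

theorem comm_sum_smul {ι : Type*} (s : Finset ι) (C : Module.End ℂ (FinVec n)) (c : ι → ℂ)
    (X : ι → Module.End ℂ (FinVec n)) :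
    comm C (∑ i ∈ s, c i • X i) = ∑ i ∈ s, c i • comm C (X i) := by
  simp only [comm, Finset.sum_mul, Finset.mul_sum, ← Finset.sum_sub_distrib, smul_mul_assoc,
    mul_smul_comm, smul_sub]

theorem comm_comm_monomial {m : ℕ} {K : Matrix (Idx n) (Idx n) ℂ} (hs : Kᵀ = K)
    (I : Fin m → Idx n) :
    comm (quadOp K) (comm (quadOp K) (monomial I)) =
      ∑ I', (derivMat m (Matrix.J (Fin n) ℂ * K) * derivMat m (Matrix.J (Fin n) ℂ * K)) I I' •
        monomial I' := by
  rw [quadOp_commutator_monomial hs, comm_sum_smul]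
  simp only [quadOp_commutator_monomial hs, Finset.smul_sum, smul_smul, Matrix.mul_apply,
    Finset.sum_smul]
  exact Finset.sum_comm

/-- With the cutoff to the left of the word, the truncated moment is the series of the moment tensor
damped term by term, so dominated convergence removes the cutoff. -/
theorem tr_diag_mul_monomial {m : ℕ} (ρ : Fock n →L[ℂ] Fock n) {f : ℤ → ℝ}
    (hf : IsFin (diag f : Module.End ℂ (FinVec n))) (I : Fin m → Idx n) :
    tr ρ (diag f * monomial I) = ∑' k : Occ n, (f (level k) : ℂ) * traceTerm ρ I k := by
  rw [← tsum_inner_adj ρ hf (isAdj_monomial I)]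
  refine tsum_congr fun k => ?_
  rw [diag_numVec, map_smul, map_smul, inner_smul_right, traceTerm]

theorem tr_diag_mul_comm_comm {m : ℕ} {K : Matrix (Idx n) (Idx n) ℂ} (hs : Kᵀ = K)
    (ρ : Fock n →L[ℂ] Fock n) {f : ℤ → ℝ} (hf : IsFin (diag f : Module.End ℂ (FinVec n)))
    (I : Fin m → Idx n) :
    tr ρ (diag f * comm (quadOp K) (comm (quadOp K) (monomial I))) =
      ((derivMat m (Matrix.J (Fin n) ℂ * K) * derivMat m (Matrix.J (Fin n) ℂ * K)) *ᵥ
        fun I' => tr ρ (diag f * monomial I')) I := by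
  have h : ∀ I' : Fin m → Idx n, IsFin (diag f * monomial I') := fun I' =>
    hf.mul_right ⟨_, isAdj_monomial I'⟩
  rw [comm_comm_monomial hs, Finset.mul_sum]
  simp only [mul_smul_comm]
  rw [tr_sum _ _ fun I' => (h I').smul _]
  simp only [tr_smul, Matrix.mulVec, dotProduct]

/-! ### Perturbed linear differential equations -/

section ode

variable {ι : Type*} [Fintype ι] [DecidableEq ι]

open scoped Matrix.Norms.Operator in
theorem hasDerivAt_exp_mulVec (G : Matrix ι ι ℂ) (v : ι → ℂ) (t : ℝ) :
    HasDerivAt (fun s : ℝ => NormedSpace.exp ((s : ℂ) • G) *ᵥ v)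
      (G *ᵥ (NormedSpace.exp ((t : ℂ) • G) *ᵥ v)) t := by
  have h1 : HasDerivAt (fun s : ℝ => NormedSpace.exp ((s : ℂ) • G))
      (G * NormedSpace.exp ((t : ℂ) • G)) t := by
    simp only [Complex.coe_smul]
    exact hasDerivAt_exp_smul_const' (𝕂 := ℝ) G t
  let Lv : Matrix ι ι ℂ →ₗ[ℝ] (ι → ℂ) :=
    { toFun := fun A => A *ᵥ v
      map_add' := fun A B => Matrix.add_mulVec A B v
      map_smul' := fun c A => Matrix.smul_mulVec c A v }
  have h2 := (LinearMap.toContinuousLinearMap Lv).hasFDerivAt.comp_hasDerivAt t h1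
  rw [Matrix.mulVec_mulVec]
  exact h2

/-- A function that satisfies `y' = G y` up to an error `δ` stays close to `exp (t G) y(0)`. -/
theorem exists_norm_sub_exp_mulVec_le (G : Matrix ι ι ℂ) {t : ℝ} (ht : 0 ≤ t) :
    ∃ c, ∀ (y y' : ℝ → ι → ℂ) (δ : ℝ), 0 ≤ δ →
      (∀ s ∈ Set.Icc 0 t, HasDerivWithinAt y (y' s) (Set.Ici 0) s) →
      (∀ s ∈ Set.Icc 0 t, ‖y' s - G *ᵥ y s‖ ≤ δ) →
      ‖y t - NormedSpace.exp ((t : ℂ) • G) *ᵥ y 0‖ ≤ c * δ := by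
  let T : (ι → ℂ) →L[ℂ] (ι → ℂ) := LinearMap.toContinuousLinearMap (Matrix.mulVecLin G)
  -- The summand 1 excludes k = 0 in Grönwall's bound and gives δ / k ≤ δ.
  set k := ‖T‖ + 1 with hk
  have hk1 : 1 ≤ k := by rw [hk]; linarith [norm_nonneg T]
  refine ⟨Real.exp (k * t), fun y y' δ hδ hy hyG => ?_⟩
  set w : ℝ → ι → ℂ := fun s => y s - NormedSpace.exp ((s : ℂ) • G) *ᵥ y 0 with hw
  set w' : ℝ → ι → ℂ := fun s => y' s - G *ᵥ (NormedSpace.exp ((s : ℂ) • G) *ᵥ y 0)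
  have hd : ∀ s ∈ Set.Icc 0 t, HasDerivWithinAt w (w' s) (Set.Ici 0) s := fun s hs =>
    (hy s hs).sub (hasDerivAt_exp_mulVec G (y 0) s).hasDerivWithinAt
  have h0 : w 0 = 0 := by simp [hw]
  have hgr := norm_le_gronwallBound_of_norm_deriv_right_le (f := w) (f' := w') (δ := 0) (K := k)
    (ε := δ) (a := 0) (b := t)
    (fun s hs => ((hd s hs).mono Set.Icc_subset_Ici_self).continuousWithinAt)
    (fun s hs => (hd s ⟨hs.1, hs.2.le⟩).mono (Set.Ici_subset_Ici.2 hs.1))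
    (by simp [h0]) (fun s hs => by
      have e : w' s = T (w s) + (y' s - G *ᵥ y s) := by
        show y' s - G *ᵥ (NormedSpace.exp ((s : ℂ) • G) *ᵥ y 0) =
          G *ᵥ (y s - NormedSpace.exp ((s : ℂ) • G) *ᵥ y 0) + (y' s - G *ᵥ y s)
        rw [Matrix.mulVec_sub]
        abel
      rw [e]
      refine (norm_add_le _ _).trans (add_le_add ((T.le_opNorm _).trans ?_)
        (hyG s ⟨hs.1, hs.2.le⟩))
      gcongr
      linarith) t ⟨ht, le_rfl⟩
  simp only [gronwallBound_of_K_ne_0 (show k ≠ 0 by linarith), sub_zero, zero_mul,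
    zero_add] at hgr
  refine hgr.trans ?_
  have h1 : 1 ≤ Real.exp (k * t) := Real.one_le_exp (by positivity)
  have h2 : δ / k ≤ δ := div_le_self hδ hk1
  nlinarith

end ode

/-! ### The moment tensor -/

section solution

variable {N : ℕ} {K : Fin N → Matrix (Idx n) (Idx n) ℂ} {ρ : ℝ → (Fock n →L[ℂ] Fock n)}

/-- The truncated moments satisfy the linear system up to `δ i`, uniformly on [0,t]. Stability
compares them with the exponential, and the limit in `i` gives equality. -/
theorem IsSolution.momentTensor_eq (hρ : IsSolution (fun j => quadOp (K j)) ρ)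
    (hs : ∀ j, (K j)ᵀ = K j) (hC : ∀ j, IsAdj (quadOp (K j)) (quadOp (K j))) {m : ℕ}
    (h0 : Summable fun k : Occ n => wt k ^ m * pop (ρ 0) k) {t : ℝ} (ht : 0 ≤ t) :
    momentTensor m (ρ t) = NormedSpace.exp ((t : ℂ) • ((-(1 / 2) : ℂ) •
      ∑ j, derivMat m (Matrix.J (Fin n) ℂ * K j) * derivMat m (Matrix.J (Fin n) ℂ * K j))) *ᵥ
        momentTensor m (ρ 0) := by
  set G : Matrix (Fin m → Idx n) (Fin m → Idx n) ℂ := (-(1 / 2) : ℂ) •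
    ∑ j, derivMat m (Matrix.J (Fin n) ℂ * K j) * derivMat m (Matrix.J (Fin n) ℂ * K j) with hG
  obtain ⟨a, ha, f, hfin, hf1, hflim, hfd, hfdd⟩ := exists_cutoffs
  have hfin' : ∀ i, IsFin (diag (f i) : Module.End ℂ (FinVec n)) := fun i => by
    obtain ⟨L, hL⟩ := hfin i
    exact isFin_diag hL
  have hR : ∀ i : ℕ, (1 : ℝ) ≤ i + 1 := fun i => by linarith [Nat.cast_nonneg (α := ℝ) i]
  have hε : ∀ i : ℕ, (0 : ℝ) ≤ 1 / (i + 1) := fun i => by positivity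
  choose c hc hcb using fun (r : Fin N × (Fin m → Idx n)) =>
    exists_norm_tr_cutError_le (hC r.1) (isAdj_monomial r.2) (hasOrder_monomial r.2)
      (hasOrder_monomialAdj r.2) (hasOrder_comm_monomial (hs r.1) r.2)
      (hasOrder_comm_monomial (hs r.1) fun l => (r.2 l.rev).swap)
  obtain ⟨M, hM⟩ := hρ.exists_tsum_momentExp_le hC h0 t
  obtain ⟨d, hd, hdb⟩ := hρ.exists_tsum_tail_le hC h0 t
  set B := Real.exp (m / 4 * Real.log 2) with hB
  have hB0 : 0 < B := Real.exp_pos _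
  -- The two parts of `cutBound` are paid for separately: the quotient of quadratics by the tail
  -- bound `d`, the constant 1/(i+1) by the moment bound `M`.
  have herr : ∀ (i : ℕ), ∀ s ∈ Set.Icc 0 t,
      (Summable fun k : Occ n => wt k ^ m * cutBound a (i + 1) (1 / (i + 1)) (level k) *
        pop (ρ s) k) ∧
      ∑' k : Occ n, wt k ^ m * cutBound a (i + 1) (1 / (i + 1)) (level k) * pop (ρ s) k ≤
        B * (a * d (i + 1) + 1 / (i + 1) * M) := fun i s hs => by
    obtain ⟨m1, m2⟩ := hM s hs
    obtain ⟨d1, d2⟩ := hdb _ (hR i) s hs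
    have hp := (hρ.isDensityMatrix s hs.1).pop_nonneg
    have hη := fun k : Occ n => cutBound_nonneg ha (hR i) (hε i) (level k)
    have hsum := ((d1.mul_left a).add (m1.mul_left (1 / (i + 1 : ℝ)))).mul_left B
    have hle : ∀ k : Occ n, wt k ^ m * cutBound a (i + 1) (1 / (i + 1)) (level k) *
        pop (ρ s) k ≤ B * (a * (Real.exp (momentExp m (level k)) *
          (quad 1 (level k) / quad (i + 1) (level k)) * pop (ρ s) k) +
          1 / (i + 1) * (Real.exp (momentExp m (level k)) * pop (ρ s) k)) := fun k => by
      refine (mul_le_mul_of_nonneg_right (mul_le_mul_of_nonneg_right (wt_pow_le_exp k m) (hη k))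
        (hp k)).trans_eq ?_
      rw [cutBound, ← hB]
      ring
    have hsum' := Summable.of_nonneg_of_le (fun k => mul_nonneg (mul_nonneg
      (pow_nonneg (wt_pos k).le m) (hη k)) (hp k)) hle hsum
    refine ⟨hsum', (hsum'.tsum_le_tsum hle hsum).trans ?_⟩
    rw [tsum_mul_left, (d1.mul_left a).tsum_add (m1.mul_left (1 / (i + 1 : ℝ))), tsum_mul_left,
      tsum_mul_left]
    have := hε i
    gcongr
  set D : ℝ := ∑ j : Fin N, ∑ I : Fin m → Idx n, c (j, I) with hD
  set δ : ℕ → ℝ := fun i => D * (B * (a * d (i + 1) + 1 / (i + 1) * M)) with hδ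
  have hD0 : 0 ≤ D := Finset.sum_nonneg fun j _ => Finset.sum_nonneg fun I _ => hc _
  have hδ0 : ∀ i, 0 ≤ δ i := fun i => by
    refine mul_nonneg hD0 (le_trans (tsum_nonneg fun k => ?_) (herr i 0 ⟨le_rfl, ht⟩).2)
    exact mul_nonneg (mul_nonneg (pow_nonneg (wt_pos k).le m)
      (cutBound_nonneg ha (hR i) (hε i) (level k)))
      ((hρ.isDensityMatrix 0 le_rfl).pop_nonneg k)
  have hδlim : Tendsto δ atTop (𝓝 0) := by
    have h1 : Tendsto (fun i : ℕ => d (i + 1)) atTop (𝓝 0) :=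
      hd.comp (tendsto_atTop_add_const_right _ _ tendsto_natCast_atTop_atTop)
    have h2 := ((h1.const_mul a).add
      ((tendsto_one_div_add_atTop_nhds_zero_nat (𝕜 := ℝ)).mul_const M)).const_mul B
    have h3 := h2.const_mul D
    simp only [mul_zero, zero_mul, add_zero] at h3
    exact h3
  set y : ℕ → ℝ → (Fin m → Idx n) → ℂ := fun i s I => tr (ρ s) (diag (f i) * monomial I) with hy
  set y' : ℕ → ℝ → (Fin m → Idx n) → ℂ := fun i s I => -(1 / 2 : ℂ) *
    ∑ j, tr (ρ s) (comm (quadOp (K j)) (comm (quadOp (K j)) (diag (f i) * monomial I))) with hy'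
  obtain ⟨c', hc'⟩ := exists_norm_sub_exp_mulVec_le G ht
  have hmain : ∀ i, ‖y i t - NormedSpace.exp ((t : ℂ) • G) *ᵥ y i 0‖ ≤ c' * δ i := fun i => by
    refine hc' (y i) (y' i) (δ i) (hδ0 i) (fun s hs => ?_) fun s hs' => ?_
    · exact hasDerivWithinAt_pi.2 fun I => hρ.hasDerivWithinAt_tr hC
        ((hfin' i).mul_right ⟨_, isAdj_monomial I⟩) hs.1
    · refine (pi_norm_le_iff_of_nonneg (hδ0 i)).2 fun I => ?_
      have e : (y' i s - G *ᵥ y i s) I =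
          -(1 / 2 : ℂ) * ∑ j, tr (ρ s) (cutError (quadOp (K j)) (monomial I) (f i)) := by
        have e1 : ∀ j, tr (ρ s)
            (comm (quadOp (K j)) (comm (quadOp (K j)) (diag (f i) * monomial I))) =
            ((derivMat m (Matrix.J (Fin n) ℂ * K j) * derivMat m (Matrix.J (Fin n) ℂ * K j)) *ᵥ
              y i s) I + tr (ρ s) (cutError (quadOp (K j)) (monomial I) (f i)) := fun j => by
          rw [comm_comm_diag_mul, tr_add, tr_diag_mul_comm_comm (hs j) _ (hfin' i)]
          · exact (hfin' i).mul_right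
              ⟨_, (hC j).commutator ((hC j).commutator (isAdj_monomial I))⟩
          · exact IsFin.cutError (hC j) (isAdj_monomial I) (hfin' i)
        rw [Pi.sub_apply, hG, Matrix.smul_mulVec, Matrix.sum_mulVec, Pi.smul_apply,
          Finset.sum_apply, hy']
        simp only [e1, Finset.sum_add_distrib, smul_eq_mul]
        ring
      rw [e, norm_mul]
      have h2 : ‖-(1 / 2 : ℂ)‖ ≤ 1 := by norm_num
      have h3 : ‖∑ j, tr (ρ s) (cutError (quadOp (K j)) (monomial I) (f i))‖ ≤
          (∑ j, c (j, I)) * (B * (a * d (i + 1) + 1 / (i + 1) * M)) := by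
        rw [Finset.sum_mul]
        refine norm_sum_le_of_le _ fun j _ => ?_
        obtain ⟨q1, q2⟩ := herr i s hs'
        exact (hcb (j, I) a (i + 1) (1 / (i + 1)) ha (hR i) (hε i) (f i) (hfin' i) (hfd i)
          (hfdd i) (ρ s) (hρ.isDensityMatrix s hs'.1) q1).trans
          (mul_le_mul_of_nonneg_left q2 (hc _))
      refine (mul_le_mul h2 h3 (norm_nonneg _) zero_le_one).trans ?_
      rw [one_mul]
      refine mul_le_mul_of_nonneg_right ?_ ?_
      · exact Finset.sum_le_sum fun j _ =>
          Finset.single_le_sum (f := fun I => c (j, I)) (fun I _ => hc _) (Finset.mem_univ I)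
      · refine le_trans (tsum_nonneg fun k => ?_) (herr i 0 ⟨le_rfl, ht⟩).2
        exact mul_nonneg (mul_nonneg (pow_nonneg (wt_pos k).le m)
          (cutBound_nonneg ha (hR i) (hε i) (level k)))
          ((hρ.isDensityMatrix 0 le_rfl).pop_nonneg k)
  have hlim : ∀ s, 0 ≤ s → Tendsto (fun i => y i s) atTop (𝓝 (momentTensor m (ρ s))) :=
    fun s hs' => by
      refine tendsto_pi_nhds.2 fun I => ?_
      have hsm := ((hρ.isDensityMatrix s hs').summable_traceTerm (hρ.summable_wt hC h0 hs') I)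
      simp only [hy, tr_diag_mul_monomial (ρ s) (hfin' _) I]
      rw [momentTensor]
      refine tendsto_tsum_of_dominated_convergence hsm.norm (fun k => ?_)
        (Eventually.of_forall fun i k => ?_)
      · have := (Complex.continuous_ofReal.tendsto 1).comp (hflim (level k) (level_nonneg k))
        simpa using this.mul_const (traceTerm (ρ s) I k)
      · rw [norm_mul, Complex.norm_real, Real.norm_eq_abs]
        exact mul_le_of_le_one_left (norm_nonneg _) (hf1 i _)
  have hcont : Continuous fun v : (Fin m → Idx n) → ℂ => NormedSpace.exp ((t : ℂ) • G) *ᵥ v :=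
    continuous_const.matrix_mulVec continuous_id
  have h1 := ((hlim t ht).sub ((hcont.tendsto _).comp (hlim 0 le_rfl))).norm
  have h2 := le_of_tendsto_of_tendsto' h1 (hδlim.const_mul c') hmain
  rw [mul_zero] at h2
  exact sub_eq_zero.1 (norm_le_zero_iff.1 h2)

end solution

/-! ### Reindexing -/

open scoped Matrix.Norms.Operator in
-- Reindexing is a continuous algebra isomorphism, hence commutes with the exponential. It serves to
-- read tensors of order one and two as families indexed by single indices and by pairs.
theorem exp_mulVec_comp {ι κ : Type*} [Fintype ι] [DecidableEq ι] [Fintype κ] [DecidableEq κ]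
    (e : κ ≃ ι) (A : Matrix ι ι ℂ) (v : ι → ℂ) :
    (NormedSpace.exp A *ᵥ v) ∘ e = NormedSpace.exp (A.submatrix e e) *ᵥ (v ∘ e) := by
  have h : (NormedSpace.exp A).submatrix e e = NormedSpace.exp (A.submatrix e e) :=
    NormedSpace.map_exp (Matrix.reindexAlgEquiv ℂ ℂ e.symm)
      (continuous_id.matrix_submatrix e e) A
  rw [← h, Matrix.submatrix_mulVec_equiv]
  simp [Function.comp_assoc]

/-- Tensors of order one are vectors. -/
def oneArrowEquiv (ι : Type*) : ι ≃ (Fin 1 → ι) where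
  toFun i := ![i]
  invFun I := I 0
  left_inv _ := rfl
  right_inv I := by
    ext l
    simp [Subsingleton.elim l 0]

end BosonicDiffusion

end


/-! ### Moments of all orders, and the cases of order one and two -/

theorem theorem1 {n N : ℕ} (K : Fin N → Matrix (Fin n ⊕ Fin n) (Fin n ⊕ Fin n) ℂ)
    (hsymm : ∀ j, (K j)ᵀ = K j) (htilde : ∀ j, BosonicDiffusion.tildeConj (K j) = K j)
    (ρ : ℝ → (BosonicDiffusion.Fock n →L[ℂ] BosonicDiffusion.Fock n))
    (hρ : BosonicDiffusion.IsSolution (fun j => BosonicDiffusion.quadOp (K j)) ρ) :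
    (∀ m : ℕ, BosonicDiffusion.FiniteMoments m (ρ 0) → ∀ t : ℝ, 0 ≤ t →
      BosonicDiffusion.FiniteMoments m (ρ t) ∧
      (∀ I : Fin m → Fin n ⊕ Fin n, Summable (BosonicDiffusion.traceTerm (ρ t) I)) ∧
      BosonicDiffusion.momentTensor m (ρ t) =
        NormedSpace.exp ((-(t / 2 : ℂ)) • ∑ j, ∑ i : Fin m, ∑ p : Fin m,
          BosonicDiffusion.kroneckerProd (fun l : Fin m =>
            (Matrix.J (Fin n) ℂ * K j) ^
              ((if i = l then 1 else 0) + (if p = l then 1 else 0)))) *ᵥ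
        BosonicDiffusion.momentTensor m (ρ 0)) ∧
    (BosonicDiffusion.FiniteMoments 1 (ρ 0) → ∀ t : ℝ, 0 ≤ t →
      (fun i : Fin n ⊕ Fin n => BosonicDiffusion.momentTensor 1 (ρ t) ![i]) =
        NormedSpace.exp ((-(t / 2 : ℂ)) • ∑ j, (Matrix.J (Fin n) ℂ * K j) ^ 2) *ᵥ
        (fun i : Fin n ⊕ Fin n => BosonicDiffusion.momentTensor 1 (ρ 0) ![i])) ∧
    (BosonicDiffusion.FiniteMoments 2 (ρ 0) → ∀ t : ℝ, 0 ≤ t →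
      (fun x : (Fin n ⊕ Fin n) × (Fin n ⊕ Fin n) =>
          BosonicDiffusion.momentTensor 2 (ρ t) ![x.1, x.2]) =
        NormedSpace.exp ((-(t / 2 : ℂ)) • ∑ j,
          ((1 : Matrix (Fin n ⊕ Fin n) (Fin n ⊕ Fin n) ℂ) ⊗ₖ
                ((Matrix.J (Fin n) ℂ * K j) ^ 2)
            + (2 : ℂ) • ((Matrix.J (Fin n) ℂ * K j) ⊗ₖ (Matrix.J (Fin n) ℂ * K j))
            + ((Matrix.J (Fin n) ℂ * K j) ^ 2) ⊗ₖ
                (1 : Matrix (Fin n ⊕ Fin n) (Fin n ⊕ Fin n) ℂ))) *ᵥ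
        (fun x : (Fin n ⊕ Fin n) × (Fin n ⊕ Fin n) =>
          BosonicDiffusion.momentTensor 2 (ρ 0) ![x.1, x.2])) := by
  have hC := fun j => BosonicDiffusion.isAdj_quadOp (hsymm j) (htilde j)
  have main : ∀ m : ℕ, BosonicDiffusion.FiniteMoments m (ρ 0) → ∀ t : ℝ, 0 ≤ t →
      BosonicDiffusion.FiniteMoments m (ρ t) ∧
      (∀ I : Fin m → Fin n ⊕ Fin n, Summable (BosonicDiffusion.traceTerm (ρ t) I)) ∧
      BosonicDiffusion.momentTensor m (ρ t) =
        NormedSpace.exp ((-(t / 2 : ℂ)) • ∑ j, ∑ i : Fin m, ∑ p : Fin m,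
          BosonicDiffusion.kroneckerProd (fun l : Fin m =>
            (Matrix.J (Fin n) ℂ * K j) ^
              ((if i = l then 1 else 0) + (if p = l then 1 else 0)))) *ᵥ
        BosonicDiffusion.momentTensor m (ρ 0) := by
    intro m hm t ht
    have h0 := ((hρ.isDensityMatrix 0 le_rfl).finiteMoments_iff m).1 hm
    have hdt := hρ.isDensityMatrix t ht
    have hwt := hρ.summable_wt hC h0 ht
    refine ⟨(hdt.finiteMoments_iff m).2 hwt, hdt.summable_traceTerm hwt, ?_⟩
    rw [hρ.momentTensor_eq hsymm hC h0 ht, smul_smul]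
    simp only [BosonicDiffusion.derivMat_mul_self]
    rw [show (t : ℂ) * -(1 / 2) = -(t / 2) by ring]
  refine ⟨main, fun h1 t ht => ?_, fun h2 t ht => ?_⟩
  · have h := congrArg (· ∘ BosonicDiffusion.oneArrowEquiv (Fin n ⊕ Fin n)) (main 1 h1 t ht).2.2
    simp only [BosonicDiffusion.exp_mulVec_comp] at h
    have e : ((-(t / 2 : ℂ)) • ∑ j, ∑ i : Fin 1, ∑ p : Fin 1,
        BosonicDiffusion.kroneckerProd (fun l : Fin 1 => (Matrix.J (Fin n) ℂ * K j) ^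
          ((if i = l then 1 else 0) + (if p = l then 1 else 0)))).submatrix
        (BosonicDiffusion.oneArrowEquiv (Fin n ⊕ Fin n))
        (BosonicDiffusion.oneArrowEquiv (Fin n ⊕ Fin n)) =
        (-(t / 2 : ℂ)) • ∑ j, (Matrix.J (Fin n) ℂ * K j) ^ 2 := by
      ext x y
      simp [Matrix.sum_apply, BosonicDiffusion.kroneckerProd, BosonicDiffusion.oneArrowEquiv]
      exact Or.inl rfl
    rw [e] at h
    exact h
  · have h := congrArg (· ∘ (finTwoArrowEquiv (Fin n ⊕ Fin n)).symm) (main 2 h2 t ht).2.2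
    simp only [BosonicDiffusion.exp_mulVec_comp] at h
    have e : ((-(t / 2 : ℂ)) • ∑ j, ∑ i : Fin 2, ∑ p : Fin 2,
        BosonicDiffusion.kroneckerProd (fun l : Fin 2 => (Matrix.J (Fin n) ℂ * K j) ^
          ((if i = l then 1 else 0) + (if p = l then 1 else 0)))).submatrix
        (finTwoArrowEquiv (Fin n ⊕ Fin n)).symm (finTwoArrowEquiv (Fin n ⊕ Fin n)).symm =
        (-(t / 2 : ℂ)) • ∑ j,
          ((1 : Matrix (Fin n ⊕ Fin n) (Fin n ⊕ Fin n) ℂ) ⊗ₖ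
                ((Matrix.J (Fin n) ℂ * K j) ^ 2)
            + (2 : ℂ) • ((Matrix.J (Fin n) ℂ * K j) ⊗ₖ (Matrix.J (Fin n) ℂ * K j))
            + ((Matrix.J (Fin n) ℂ * K j) ^ 2) ⊗ₖ
                (1 : Matrix (Fin n ⊕ Fin n) (Fin n ⊕ Fin n) ℂ)) := by
      ext x y
      simp only [Matrix.submatrix_apply, Matrix.smul_apply, Matrix.sum_apply, Matrix.add_apply,
        Matrix.kroneckerMap_apply, BosonicDiffusion.kroneckerProd, Matrix.of_apply,
        Fin.sum_univ_two, Fin.prod_univ_two, finTwoArrowEquiv_symm_apply]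
      congr 1
      -- The pairs i = p give the two squares, and the two pairs i ≠ p give the same mixed product,
      -- whence the factor 2.
      refine Finset.sum_congr rfl fun j _ => ?_
      simp
      ring
    rw [e] at h
    exact h
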